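/- Let $(X_t,Y_t)_{t\ge 0}$ be a hidden Markov model with $n$ hidden states, column-stochastic transition matrix $A$ ($A_{ij}=P(X_{t+1}=i\mid X_t=j)$) and arbitrary initial distribution. Assume that the hidden chain has a unique stationary distribution $\pi$, with $\min_k\pi_k\ge a_0>0$, and is geometrically ergodic: there are $G<\infty$ and $\psi\in[0,1)$ with $\|A^tP_0-\pi\|_1\le 2G\psi^t$ for all $t\in\mathbb N$ and all initial distributions $P_0$. Write $\|x\|_w^2=\sum_i w_ix_i^2$, where in a weight $1/r$ the terms with $r_i=0$ are omitted (that is, $1/0:=0$). For a vector $p\in\mathbb R^n$, a matrix $F$ and an array $s=(s_{kk'})$ let $\mathrm{QP}(p,F,s)$ be the problem of minimizing $$\|s-CM\|_{1/s}^2,\qquad (CM)_{kk'}=\sum_{i,j}p_jF_{kj}F_{k'i}M_{ij},$$ over the matrices $M$ with $M_{ij}\ge 0$, $\sum_iM_{ij}=1$ and $Mp=p$. **Discrete case.** Let $Y_t$ take values in $\{1,\dots,m\}$ with known output probabilities $B_{ki}=P(Y_t=k\mid X_t=i)$, and assume $\mathrm{rank}(B)=n$. Put $$\hat\rho_k=\frac1T\sum_{t=0}^{T-1}\mathbf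 1\{Y_t=k\},\qquad \hat\sigma_{kk'}=\frac1{T-1}\sum_{t=1}^{T-1}\mathbf 1\{Y_{t-1}=k\}\mathbf 1\{Y_t=k'\},$$ $W=B^{\top}\mathrm{diag}(1/\hat\rho)B$, $x^*=W^{-1}\mathbf 1$ and $\hat\pi=x^*/\|x^*\|_1$ (with an arbitrary fixed convention when $W$ is singular), and let $\hat A$ be any solution of $\mathrm{QP}(\hat\pi,B,\hat\sigma)$. Then, with probability one, $\hat\pi\to\pi$ and $\hat A\to A$ as $T\to\infty$. **Continuous case.** Let $Y_t$ take values in a measure space, with known probability densities $f_i$ of $Y_t$ given $X_t=i$, such that all $K_{ij}=\int f_i(y)f_j(y)\,dy$ are finite. For a probability vector $p$ put $$P_p(k\mid y)=\frac{f_k(y)p_k}{\sum_l f_l(y)p_l},\qquad F^{(p)}_{kj}=\int P_p(k\mid y)f_j(y)\,dy ,\qquad F=F^{(\pi)},$$ and assume $\mathrm{rank}(K)=\mathrm{rank}(F)=n$. Put $\hat\xi_k=\frac1T\sum_{t=0}^{T-1}f_k(Y_t)$, let $\hat\pi$ be any minimizer of $\|\hat\xi-Kx\|_{1/\hat\xi}^2$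 over the probability vectors $x\in\mathbb R^n$, put $\hat\eta_{kk'}=\frac1{T-1}\sum_{t=1}^{T-1}P_{\hat\pi}(k\mid Y_{t-1})P_{\hat\pi}(k'\mid Y_t)$, and let $\hat A$ be any solution of $\mathrm{QP}(\hat\pi,F,\hat\eta)$, or any solution of $\mathrm{QP}(\hat\pi,F^{(\hat\pi)},\hat\eta)$. Then, with probability one, $\hat\pi\to\pi$ and $\hat A\to A$ as $T\to\infty$. -/

import Mathlib

open MeasureTheory Filter Topology

namespace HMM

/-! ### The hidden chain -/

/-- `B i j` is the probability of `i` given `j`: nonnegative entries, each column sums to one. -/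
def IsColStochastic {κ ι : Type*} [Fintype κ] (B : Matrix κ ι ℝ) : Prop :=
  (∀ k i, 0 ≤ B k i) ∧ ∀ i, ∑ k, B k i = 1

/-- `p` is a probability vector with `A p = p`. -/
def IsStationary {n : ℕ} (A : Matrix (Fin n) (Fin n) ℝ) (p : Fin n → ℝ) : Prop :=
  p ∈ stdSimplex ℝ (Fin n) ∧ A.mulVec p = p

/-- From every initial distribution `p`, `‖A ^ t p - π‖₁ ≤ 2 G ψ ^ t` for all `t`,
with constants `G < ∞` and `ψ ∈ [0, 1)`. -/
def IsGeometricallyErgodic {n : ℕ} (A : Matrix (Fin n) (Fin n) ℝ) (π : Fin n → ℝ) : Prop :=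
  ∃ G ψ : ℝ, 0 ≤ ψ ∧ ψ < 1 ∧ ∀ p ∈ stdSimplex ℝ (Fin n), ∀ t : ℕ,
    ∑ i, |((A ^ t).mulVec p) i - π i| ≤ 2 * G * ψ ^ t

/-! ### Hidden Markov models -/

/-- `(X, Y)` is, under the probability measure `P`, a hidden Markov model with (column stochastic)
transition matrix `A`, initial distribution `p₀` and emission laws `Q i`:
the joint law of `(X₀, Y₀), …, (X_T, Y_T)` is
`p₀(x₀) ∏ A(x_{t+1}, x_t) ∏ Q_{x_t}(dy_t)`. -/
structure IsHMM {n : ℕ} {Ω 𝒴 : Type*} [MeasurableSpace Ω] [MeasurableSpace 𝒴]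
    (P : Measure Ω) (A : Matrix (Fin n) (Fin n) ℝ) (p₀ : Fin n → ℝ) (Q : Fin n → Measure 𝒴)
    (X : ℕ → Ω → Fin n) (Y : ℕ → Ω → 𝒴) : Prop where
  measurable_hidden : ∀ t, Measurable (X t)
  measurable_output : ∀ t, Measurable (Y t)
  law : ∀ (T : ℕ) (x : ℕ → Fin n) (S : ℕ → Set 𝒴), (∀ t, MeasurableSet (S t)) →
    P {ω | ∀ t ∈ Finset.range (T + 1), X t ω = x t ∧ Y t ω ∈ S t} =
      ENNReal.ofReal (p₀ (x 0)) *
        (∏ t ∈ Finset.range T, ENNReal.ofReal (A (x (t + 1)) (x t))) *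
        ∏ t ∈ Finset.range (T + 1), Q (x t) (S t)

/-- Emission laws on a finite alphabet: output `k` has probability `B k i` in state `i`. -/
noncomputable def discreteEmission {n m : ℕ} (B : Matrix (Fin m) (Fin n) ℝ) (i : Fin n) :
    Measure (Fin m) :=
  ∑ k, ENNReal.ofReal (B k i) • Measure.dirac k

/-- `g` is a probability density with respect to `ν`. -/
structure IsDensity {𝒴 : Type*} [MeasurableSpace 𝒴] (ν : Measure 𝒴) (g : 𝒴 → ℝ) : Prop where
  measurable : Measurable g
  nonneg : ∀ y, 0 ≤ g y
  lintegral_eq_one : ∫⁻ y, ENNReal.ofReal (g y) ∂ν = 1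

/-- Emission laws with densities `f i` with respect to `ν`. -/
noncomputable def densityEmission {n : ℕ} {𝒴 : Type*} [MeasurableSpace 𝒴] (ν : Measure 𝒴)
    (f : Fin n → 𝒴 → ℝ) (i : Fin n) : Measure 𝒴 :=
  ν.withDensity fun y => ENNReal.ofReal (f i y)

/-! ### Quadratic programs. Division by zero gives zero, so in `‖·‖²_{1/r}` the terms with
`r = 0` are omitted. -/

/-- The weighted square `‖x‖²_w = ∑ w_i x_i²`. -/
def wnormSq {ι : Type*} [Fintype ι] (w x : ι → ℝ) : ℝ := ∑ i, w i * x i ^ 2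

/-- `x` minimizes `‖r - K x‖²_{1/r}` over the probability vectors. -/
def IsMixtureEstimate {n : ℕ} (K : Matrix (Fin n) (Fin n) ℝ) (r : Fin n → ℝ)
    (x : Fin n → ℝ) : Prop :=
  x ∈ stdSimplex ℝ (Fin n) ∧
    IsMinOn (fun z => wnormSq (fun k => 1 / r k) (fun k => r k - (K.mulVec z) k))
      (stdSimplex ℝ (Fin n)) x

/-- `(C M)_{k,k'} = ∑_{i,j} C_{ij}^{kk'} M_{ij}` with `C_{ij}^{kk'} = p_j F_{kj} F_{k'i}`. -/
def pairMap {n : ℕ} {κ : Type*} (p : Fin n → ℝ) (F : Matrix κ (Fin n) ℝ)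
    (M : Matrix (Fin n) (Fin n) ℝ) (q : κ × κ) : ℝ :=
  ∑ i, ∑ j, p j * F q.1 j * F q.2 i * M i j

/-- The column stochastic matrices `M` with `M p = p`. -/
def feasibleTransitions {n : ℕ} (p : Fin n → ℝ) : Set (Matrix (Fin n) (Fin n) ℝ) :=
  {M | (∀ i j, 0 ≤ M i j) ∧ (∀ j, ∑ i, M i j = 1) ∧ M.mulVec p = p}

/-- `M` minimizes `‖s - C M‖²_{1/s}` over the column stochastic matrices fixing `p`. -/
def IsTransitionEstimate {n : ℕ} {κ : Type*} [Fintype κ] (p : Fin n → ℝ)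
    (F : Matrix κ (Fin n) ℝ) (s : κ → κ → ℝ) (M : Matrix (Fin n) (Fin n) ℝ) : Prop :=
  M ∈ feasibleTransitions p ∧
    IsMinOn (fun N => wnormSq (fun q : κ × κ => 1 / s q.1 q.2)
      (fun q => s q.1 q.2 - pairMap p F N q)) (feasibleTransitions p) M

/-- The first program always has a solution (for `n ≥ 1`). -/
theorem exists_isMixtureEstimate {n : ℕ} [NeZero n] (K : Matrix (Fin n) (Fin n) ℝ)
    (r : Fin n → ℝ) : ∃ x, IsMixtureEstimate K r x := by
  refine (isCompact_stdSimplex ℝ (Fin n)).exists_isMinOn ⟨_, single_mem_stdSimplex ℝ (0 : Fin n)⟩ ?_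
  unfold wnormSq Matrix.mulVec dotProduct
  fun_prop

/-- The second program always has a solution. -/
theorem exists_isTransitionEstimate {n : ℕ} {κ : Type*} [Fintype κ] (p : Fin n → ℝ)
    (F : Matrix κ (Fin n) ℝ) (s : κ → κ → ℝ) : ∃ M, IsTransitionEstimate p F s M := by
  have hc : IsCompact (feasibleTransitions p) := by
    have hbox : IsCompact (Set.pi Set.univ fun _ : Fin n => Set.pi Set.univ
        fun _ : Fin n => Set.Icc (0 : ℝ) 1) :=
      isCompact_univ_pi fun _ => isCompact_univ_pi fun _ => isCompact_Icc
    refine hbox.of_isClosed_subset ?_ ?_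
    · have h1 : IsClosed {M : Matrix (Fin n) (Fin n) ℝ | ∀ i j, 0 ≤ M i j} := by
        simp only [Set.ofPred_forall]
        exact isClosed_iInter fun i => isClosed_iInter fun j =>
          isClosed_le continuous_const (by fun_prop)
      have h2 : IsClosed {M : Matrix (Fin n) (Fin n) ℝ | ∀ j, ∑ i, M i j = 1} := by
        simp only [Set.ofPred_forall]
        exact isClosed_iInter fun j => isClosed_eq (by fun_prop) continuous_const
      have h3 : IsClosed {M : Matrix (Fin n) (Fin n) ℝ | M.mulVec p = p} :=
        isClosed_eq (by unfold Matrix.mulVec dotProduct; fun_prop) continuous_const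
      exact h1.inter (h2.inter h3)
    · rintro M ⟨h1, h2, -⟩ i - j -
      refine ⟨h1 i j, ?_⟩
      rw [← h2 j]
      exact Finset.single_le_sum (f := fun i => M i j) (fun i _ => h1 i j) (Finset.mem_univ i)
  refine hc.exists_isMinOn ⟨1, ?_, ?_, Matrix.one_mulVec p⟩ ?_
  · intro i j
    by_cases h : i = j <;> simp [Matrix.one_apply, h]
  · intro j
    simp [Matrix.one_apply]
  · unfold wnormSq pairMap
    fun_prop

/-! ### Estimators, finite alphabet -/

/-- `ρ̂_k = (1/T) #{t < T : y_t = k}`. -/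
noncomputable def rhoHat {m : ℕ} (y : ℕ → Fin m) (T : ℕ) (k : Fin m) : ℝ :=
  1 / (T : ℝ) * ∑ t ∈ Finset.range T, if y t = k then 1 else 0

/-- `σ̂_{k,k'} = (1/(T-1)) #{1 ≤ t < T : y_{t-1} = k, y_t = k'}`. -/
noncomputable def sigmaHat {m : ℕ} (y : ℕ → Fin m) (T : ℕ) (k k' : Fin m) : ℝ :=
  1 / ((T : ℝ) - 1) * ∑ t ∈ Finset.Ico 1 T,
    (if y (t - 1) = k then 1 else 0) * (if y t = k' then 1 else 0)

/-- `x* / ‖x*‖₁`, where `x* = W⁻¹ 1` and `W = Bᵀ diag(1/r) B`. -/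
noncomputable def piHat {n m : ℕ} (B : Matrix (Fin m) (Fin n) ℝ) (r : Fin m → ℝ) :
    Fin n → ℝ :=
  let W : Matrix (Fin n) (Fin n) ℝ := B.transpose * Matrix.diagonal (fun k => 1 / r k) * B
  let x : Fin n → ℝ := W⁻¹.mulVec (fun _ => 1)
  fun i => x i / ∑ j, |x j|

/-! ### Estimators, outputs with densities -/

section Density

variable {n : ℕ} {𝒴 : Type*}

/-- `K_{ij} = ∫ f_i f_j`. -/
noncomputable def kMatrix [MeasurableSpace 𝒴] (ν : Measure 𝒴) (f : Fin n → 𝒴 → ℝ) :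
    Matrix (Fin n) (Fin n) ℝ :=
  Matrix.of fun i j => ∫ y, f i y * f j y ∂ν

/-- The posterior probability `f_k(y) p_k / ∑_l f_l(y) p_l` of state `k` given the output `y`. -/
noncomputable def posterior (f : Fin n → 𝒴 → ℝ) (p : Fin n → ℝ) (k : Fin n) (y : 𝒴) : ℝ :=
  f k y * p k / ∑ l, f l y * p l

/-- `F_{kj} = ∫ P(k | y) f_j(y) dy`, the posterior being computed with state probabilities `p`. -/
noncomputable def fMatrix [MeasurableSpace 𝒴] (ν : Measure 𝒴) (f : Fin n → 𝒴 → ℝ)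
    (p : Fin n → ℝ) : Matrix (Fin n) (Fin n) ℝ :=
  Matrix.of fun k j => ∫ y, posterior f p k y * f j y ∂ν

/-- `ξ̂_k = (1/T) ∑_{t<T} f_k(y_t)`. -/
noncomputable def xiHat (f : Fin n → 𝒴 → ℝ) (y : ℕ → 𝒴) (T : ℕ) (k : Fin n) : ℝ :=
  1 / (T : ℝ) * ∑ t ∈ Finset.range T, f k (y t)

/-- `η̂_{k,k'} = (1/(T-1)) ∑_{1≤t<T} P̂(k | y_{t-1}) P̂(k' | y_t)`, the posteriors being computed
with state probabilities `p`. -/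
noncomputable def etaHat (f : Fin n → 𝒴 → ℝ) (p : Fin n → ℝ) (y : ℕ → 𝒴) (T : ℕ)
    (k k' : Fin n) : ℝ :=
  1 / ((T : ℝ) - 1) * ∑ t ∈ Finset.Ico 1 T, posterior f p k (y (t - 1)) * posterior f p k' (y t)

end Density

end HMM

/-! Consistency splits into a probabilistic half, the almost sure convergence of the empirical
averages, and a deterministic half, in which the estimates follow those averages.

Probabilistic half. Every average needed has terms `a (Y t) * b (Y (t + 1))` with `a ≥ 0` integrable
under all emission laws and `0 ≤ b ≤ 1` (`IsHMM.ae_tendsto_average`). Finiteness of `K` gives only a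
first moment of `f k` under the emission laws, so `a` is truncated at level `t`. The Markov
property, in the form of a recursion for the vectors `E[U; X s = i]` (`IsHMM.occupation_succ`), and
geometric ergodicity make covariances decay geometrically, with constants involving only first
moments of `a` (`IsHMM.abs_covariance_le`). Chebyshev and Borel-Cantelli along `⌊c ^ N⌋`, followed
by monotone interpolation, then give the law of large numbers from any initial distribution, as in
Etemadi's argument.

Deterministic half. Residuals tend to zero at a feasible comparison point: `π` itself in the first
program, and in the second a stochastic matrix fixing `p T` and tending to `A`
(`exists_feasible_tendsto`). Hence the minimal values tend to zero, and so do the residuals on all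
cells whose limit is positive. In the second program the remaining cells carry no weight, but the
total mass is one, so the mass that the estimate puts there vanishes as well. Full rank then
recovers `A` (`tendsto_of_isTransitionEstimate`). The explicit discrete `piHat` converges by
continuity of the matrix inverse (`tendsto_piHat`).

The weights `1 / s` could blow up where the limit of `s` is zero. They do not, because almost surely
such an `s` is exactly zero and its cell is omitted (`IsHMM.ae_eq_zero_of_pairMean_eq_zero`). In the
continuous case the posteriors use estimated probabilities; they depend on these uniformly in the
output (`abs_posterior_sub_le`). -/

namespace HMM

/-! ### A strong law from variance bounds -/

section StrongLaw

open ProbabilityTheory Finset Asymptotics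

variable {Ω : Type*} [MeasurableSpace Ω] {P : Measure Ω} [IsProbabilityMeasure P]
  {Z : ℕ → Ω → ℝ} {w : ℕ → ℝ} {D : ℝ}

/-- Deviations along a geometric sequence are eventually small, from a variance bound. -/
theorem ae_eventually_abs_sub_lt_floor_pow (hZ : ∀ t, MemLp (Z t) 2 P) (hw : ∀ t, 0 ≤ w t)
    (hw0 : w 0 = 0) (hvar : ∀ N, Var[∑ t ∈ range N, Z t; P] ≤ ∑ t ∈ range N, w t)
    (hD : ∀ K, ∑ j ∈ range K, ((j : ℝ) ^ 2)⁻¹ * w j ≤ D)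
    {c : ℝ} (c_one : 1 < c) {ε : ℝ} (εpos : 0 < ε) :
    ∀ᵐ ω ∂P, ∀ᶠ N : ℕ in atTop,
      |∑ t ∈ range ⌊c ^ N⌋₊, Z t ω - P[∑ t ∈ range ⌊c ^ N⌋₊, Z t]| < ε * ⌊c ^ N⌋₊ := by
  have c_pos : 0 < c := zero_lt_one.trans c_one
  set S := fun N => ∑ t ∈ range N, Z t with hS
  let u : ℕ → ℕ := fun n => ⌊c ^ n⌋₊
  have u_mono : Monotone u := fun i j hij => Nat.floor_mono (pow_right_mono₀ c_one.le hij)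
  let C := c ^ 5 * (c - 1)⁻¹ ^ 3 * D
  have I2 : ∀ N, ∑ i ∈ range N, ((u i : ℝ) ^ 2)⁻¹ * Var[S (u i); P] ≤ C := by
    intro N
    calc
      ∑ i ∈ range N, ((u i : ℝ) ^ 2)⁻¹ * Var[S (u i); P] ≤
          ∑ i ∈ range N, ((u i : ℝ) ^ 2)⁻¹ * ∑ j ∈ range (u i), w j := by
        gcongr with i
        exact hvar _
      -- The sums are exchanged: `u` is monotone, so `j < u i` with `i < N` forces `j < u (N - 1)`.
      _ = ∑ j ∈ range (u (N - 1)), (∑ i ∈ range N with j < u i, ((u i : ℝ) ^ 2)⁻¹) * w j := by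
        simp_rw [mul_sum, sum_mul, sum_sigma']
        refine sum_nbij' (fun p ↦ ⟨p.2, p.1⟩) (fun p ↦ ⟨p.2, p.1⟩) ?_ ?_ ?_ ?_ ?_
        · simp only [mem_sigma, mem_range, mem_filter, and_imp, Sigma.forall]
          exact fun a b haN hb ↦ ⟨hb.trans_le <| u_mono <| Nat.le_pred_of_lt haN, haN, hb⟩
        all_goals simp
      _ ≤ ∑ j ∈ range (u (N - 1)), c ^ 5 * (c - 1)⁻¹ ^ 3 / ↑j ^ 2 * w j := by
        gcongr ∑ _ ∈ _, ?_ with j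
        rcases Nat.eq_zero_or_pos j with (rfl | hj)
        -- Here `1 / j ^ 2` is zero by convention, so the bound needs `w 0 = 0`.
        · simp [hw0]
        apply mul_le_mul_of_nonneg_right _ (hw j)
        convert! sum_div_nat_floor_pow_sq_le_div_sq N (Nat.cast_pos.2 hj) c_one using 2
        · simp only [u, Nat.cast_lt]
        · simp only [u, one_div]
      _ = c ^ 5 * (c - 1)⁻¹ ^ 3 * ∑ j ∈ range (u (N - 1)), ((j : ℝ) ^ 2)⁻¹ * w j := by
        simp_rw [mul_sum, div_eq_mul_inv, mul_assoc]
      _ ≤ C := by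
        apply mul_le_mul_of_nonneg_left (hD _)
        apply mul_nonneg (pow_nonneg c_pos.le _)
        exact pow_nonneg (inv_nonneg.2 (sub_nonneg.2 c_one.le)) _
  have I3 : ∀ N, ∑ i ∈ range N, P {ω | (u i * ε : ℝ) ≤ |S (u i) ω - P[S (u i)]|} ≤
      ENNReal.ofReal (ε⁻¹ ^ 2 * C) := by
    intro N
    calc
      ∑ i ∈ range N, P {ω | (u i * ε : ℝ) ≤ |S (u i) ω - P[S (u i)]|} ≤
          ∑ i ∈ range N, ENNReal.ofReal (Var[S (u i); P] / (u i * ε) ^ 2) := by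
        gcongr with i _
        apply meas_ge_le_variance_div_sq
        · exact memLp_finsetSum' _ fun j _ => hZ j
        · apply mul_pos (Nat.cast_pos.2 _) εpos
          refine zero_lt_one.trans_le ?_
          apply Nat.le_floor
          rw [Nat.cast_one]
          apply one_le_pow₀ c_one.le
      _ = ENNReal.ofReal (∑ i ∈ range N, Var[S (u i); P] / (u i * ε) ^ 2) := by
        rw [ENNReal.ofReal_sum_of_nonneg fun i _ => ?_]
        exact div_nonneg (variance_nonneg _ _) (sq_nonneg _)
      _ ≤ ENNReal.ofReal (ε⁻¹ ^ 2 * C) := by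
        apply ENNReal.ofReal_le_ofReal
        simp_rw [div_eq_inv_mul, ← inv_pow, mul_inv, mul_comm _ (ε⁻¹), mul_pow, mul_assoc,
          ← mul_sum]
        gcongr
        simpa only [inv_pow] using I2 N
  have I4 : (∑' i, P {ω | (u i * ε : ℝ) ≤ |S (u i) ω - P[S (u i)]|}) < ⊤ :=
    (le_of_tendsto_of_tendsto' (ENNReal.tendsto_nat_tsum _) tendsto_const_nhds I3).trans_lt
      ENNReal.ofReal_lt_top
  filter_upwards [ae_eventually_notMem I4.ne] with ω hω
  simp_rw [S, not_le, mul_comm, Finset.sum_apply] at hω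
  convert! hω; simp only [u, Finset.sum_apply]

/-- A strong law of large numbers for nonnegative variables, from a variance bound
`Var[∑ t < N, Z t] ≤ ∑ t < N, w t` with `∑ w t / t ^ 2 < ∞`. -/
theorem ae_tendsto_sum_div_of_variance_le (hZ : ∀ t, MemLp (Z t) 2 P)
    (hnonneg : ∀ t ω, 0 ≤ Z t ω) (hw : ∀ t, 0 ≤ w t)
    (hw0 : w 0 = 0) (hvar : ∀ N, Var[∑ t ∈ range N, Z t; P] ≤ ∑ t ∈ range N, w t)
    (hD : ∀ K, ∑ j ∈ range K, ((j : ℝ) ^ 2)⁻¹ * w j ≤ D)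
    {m : ℝ} (hm : Tendsto (fun t => P[Z t]) atTop (𝓝 m)) :
    ∀ᵐ ω ∂P, Tendsto (fun N : ℕ => (∑ t ∈ range N, Z t ω) / N) atTop (𝓝 m) := by
  have mean : (fun N : ℕ => P[∑ t ∈ range N, Z t] - N * m) =o[atTop] ((↑) : ℕ → ℝ) := by
    convert! Asymptotics.isLittleO_sum_range_of_tendsto_zero (tendsto_sub_nhds_zero_iff.2 hm)
      using 1
    ext1 N
    simp only [sum_sub_distrib, sum_const, card_range, nsmul_eq_mul, Finset.sum_apply,
      sub_left_inj]
    rw [integral_finsetSum _ fun i _ => ?_]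
    exact (hZ i).integrable one_le_two
  have geom : ∀ {c : ℝ}, 1 < c → ∀ᵐ ω ∂P, Tendsto
      (fun N : ℕ => (∑ t ∈ range ⌊c ^ N⌋₊, Z t ω) / ⌊c ^ N⌋₊) atTop (𝓝 m) := by
    intro c c_one
    have H : ∀ n : ℕ, (0 : ℝ) < ⌊c ^ n⌋₊ := by
      intro n
      refine zero_lt_one.trans_le ?_
      simp only [Nat.one_le_cast, Nat.one_le_floor_iff, one_le_pow₀ c_one.le]
    have A : Tendsto (fun n : ℕ => ⌊c ^ n⌋₊) atTop atTop :=
      tendsto_nat_floor_atTop.comp (tendsto_pow_atTop_atTop_of_one_lt c_one)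
    obtain ⟨v, -, v_pos, v_lim⟩ :
        ∃ v : ℕ → ℝ, StrictAnti v ∧ (∀ n : ℕ, 0 < v n) ∧ Tendsto v atTop (𝓝 0) :=
      exists_seq_strictAnti_tendsto (0 : ℝ)
    have := fun i => ae_eventually_abs_sub_lt_floor_pow hZ hw hw0 hvar hD c_one (v_pos i)
    filter_upwards [ae_all_iff.2 this] with ω hω
    have hdev : (fun n : ℕ => ∑ i ∈ range ⌊c ^ n⌋₊, Z i ω - P[∑ i ∈ range ⌊c ^ n⌋₊, Z i])
        =o[atTop] fun n : ℕ => (⌊c ^ n⌋₊ : ℝ) := by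
      apply Asymptotics.isLittleO_iff.2 fun ε εpos => ?_
      obtain ⟨i, hi⟩ : ∃ i, v i < ε := ((tendsto_order.1 v_lim).2 ε εpos).exists
      filter_upwards [hω i] with n hn
      simp only [Real.norm_eq_abs, Nat.abs_cast]
      exact hn.le.trans (mul_le_mul_of_nonneg_right hi.le (Nat.cast_nonneg _))
    rw [← tendsto_sub_nhds_zero_iff, ← Asymptotics.isLittleO_one_iff ℝ]
    have L : (fun n : ℕ => ∑ i ∈ range ⌊c ^ n⌋₊, Z i ω - ⌊c ^ n⌋₊ * m) =o[atTop] fun n =>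
        (⌊c ^ n⌋₊ : ℝ) := by
      convert! hdev.add (mean.comp_tendsto A) using 1
      ext1 n
      simp
    convert! L.mul_isBigO (isBigO_refl (fun n : ℕ => (⌊c ^ n⌋₊ : ℝ)⁻¹) atTop) using 1 <;>
    (ext1 n; field [(H n).ne'])
  obtain ⟨c, -, cone, clim⟩ :
      ∃ c : ℕ → ℝ, StrictAnti c ∧ (∀ n : ℕ, 1 < c n) ∧ Tendsto c atTop (𝓝 1) :=
    exists_seq_strictAnti_tendsto (1 : ℝ)
  filter_upwards [ae_all_iff.2 fun k => geom (cone k)] with ω hω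
  -- Nonnegativity makes the partial sums monotone; between consecutive `⌊c ^ n⌋` the averages then
  -- vary by a factor of about `c`, and `c` tends to 1.
  apply tendsto_div_of_monotone_of_tendsto_div_floor_pow _ _ _ c cone clim _
  · intro m n hmn
    exact sum_le_sum_of_subset_of_nonneg (range_mono hmn) fun i _ _ => hnonneg i ω
  · exact hω

end StrongLaw

/-! ### Markov property for integrals of output functionals -/

section Moments

open Finset

variable {n : ℕ} {Ω 𝒴 : Type*} [MeasurableSpace 𝒴] {X : ℕ → Ω → Fin n} {Y : ℕ → Ω → 𝒴}

/-- `U` is a finite product of bounded measurable functions of the outputs up to time `s`. -/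
def IsPastProduct (Y : ℕ → Ω → 𝒴) (s : ℕ) (U : Ω → ℝ) : Prop :=
  ∃ φ : ℕ → 𝒴 → ℝ, (∀ t, Measurable (φ t)) ∧ (∀ t, ∃ C, ∀ y, |φ t y| ≤ C) ∧
    U = fun ω => ∏ t ∈ range (s + 1), φ t (Y t ω)

theorem IsPastProduct.exists_bound {s : ℕ} {U : Ω → ℝ} (hU : IsPastProduct Y s U) :
    ∃ C, ∀ ω, |U ω| ≤ C := by
  obtain ⟨φ, -, hb, rfl⟩ := hU
  choose C hC using hb
  refine ⟨∏ t ∈ range (s + 1), C t, fun ω => ?_⟩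
  rw [abs_prod]
  exact prod_le_prod (fun _ _ => abs_nonneg _) fun t _ => hC t _

theorem isPastProduct_one (s : ℕ) : IsPastProduct Y s fun _ => 1 :=
  ⟨fun _ _ => 1, fun _ => measurable_const, fun _ => ⟨1, fun _ => by simp⟩, by simp⟩

theorem isPastProduct_output {ψ : 𝒴 → ℝ} (hψ : Measurable ψ) (hb : ∃ C, ∀ y, |ψ y| ≤ C) (s : ℕ) :
    IsPastProduct Y s fun ω => ψ (Y s ω) := by
  refine ⟨fun t => if t = s then ψ else 1, fun t => ?_, fun t => ?_, ?_⟩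
  · dsimp only; split_ifs
    exacts [hψ, measurable_const]
  · dsimp only; split_ifs
    exacts [hb, ⟨1, fun _ => by simp⟩]
  · ext ω
    rw [prod_eq_single s]
    · simp
    · intro t _ ht; simp [ht]
    · simp

theorem IsPastProduct.mul_output {s : ℕ} {U : Ω → ℝ} (hU : IsPastProduct Y s U) {ψ : 𝒴 → ℝ}
    (hψ : Measurable ψ) (hb : ∃ C, ∀ y, |ψ y| ≤ C) :
    IsPastProduct Y (s + 1) fun ω => U ω * ψ (Y (s + 1) ω) := by
  obtain ⟨φ, hm, hφ, rfl⟩ := hU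
  refine ⟨fun t => if t = s + 1 then ψ else φ t, fun t => ?_, fun t => ?_, ?_⟩
  · dsimp only; split_ifs
    exacts [hψ, hm t]
  · dsimp only; split_ifs
    exacts [hb, hφ t]
  · ext ω
    rw [prod_range_succ _ (s + 1)]
    simp only [if_true]
    congr 1
    refine prod_congr rfl fun t ht => ?_
    rw [if_neg (by have := mem_range.1 ht; omega)]

variable [MeasurableSpace Ω] {P : Measure Ω}

/-- The vector `i ↦ E[U; X s = i]`. -/
noncomputable def occupation (P : Measure Ω) (X : ℕ → Ω → Fin n) (U : Ω → ℝ) (s : ℕ) (i : Fin n) :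
    ℝ :=
  ∫ ω in {ω | X s ω = i}, U ω ∂P

theorem sum_occupation (hX : ∀ t, Measurable (X t)) {U : Ω → ℝ} (hU : Integrable U P) (s : ℕ) :
    ∑ i, occupation P X U s i = ∫ ω, U ω ∂P := by
  unfold occupation
  rw [← integral_iUnion_fintype]
  · have : (⋃ i, {ω | X s ω = i}) = Set.univ := by ext; simp
    rw [this, setIntegral_univ]
  · exact fun i => hX s (measurableSet_singleton i)
  · intro i j hij
    exact Set.disjoint_left.2 fun ω h1 h2 => hij (h1.symm.trans h2)
  · exact fun i => hU.integrableOn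

variable {A : Matrix (Fin n) (Fin n) ℝ} {p₀ : Fin n → ℝ}
  {Q : Fin n → Measure 𝒴} [∀ i, IsProbabilityMeasure (Q i)]

/-- Given the hidden path, the outputs are independent with laws `Q (x t)`. -/
theorem IsHMM.setIntegral_path_prod (h : IsHMM P A p₀ Q X Y) (hA : ∀ i j, 0 ≤ A i j)
    (hp₀ : ∀ i, 0 ≤ p₀ i) (T : ℕ) (x : ℕ → Fin n) {φ : ℕ → 𝒴 → ℝ} (hφ : ∀ t, Measurable (φ t)) :
    ∫ ω in {ω | ∀ t ∈ range (T + 1), X t ω = x t}, ∏ t ∈ range (T + 1), φ t (Y t ω) ∂P =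
      p₀ (x 0) * (∏ t ∈ range T, A (x (t + 1)) (x t)) *
        ∏ t ∈ range (T + 1), ∫ y, φ t y ∂(Q (x t)) := by
  -- The probability of the path is distributed over the coordinates, one factor per time. On the
  -- path event the law of the outputs is then a product of finite measures, and Fubini applies.
  let c : Fin (T + 1) → ENNReal :=
    Fin.cons (ENNReal.ofReal (p₀ (x 0))) fun t => ENNReal.ofReal (A (x (t + 1)) (x t))
  have hc : ∀ t, c t ≠ ⊤ := by
    intro t
    refine Fin.cases ?_ (fun t => ?_) t <;> simp [c]
  have hfin : ∀ t : Fin (T + 1), IsFiniteMeasure (c t • Q (x t)) :=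
    fun t => Measure.smul_finite _ (hc t)
  have hYm : Measurable fun ω (t : Fin (T + 1)) => Y t ω :=
    measurable_pi_lambda _ fun t => h.measurable_output t
  have hpi : Measure.pi (fun t : Fin (T + 1) => c t • Q (x t)) =
      (P.restrict {ω | ∀ t ∈ range (T + 1), X t ω = x t}).map
        (fun ω (t : Fin (T + 1)) => Y t ω) := by
    refine Measure.pi_eq fun s hs => ?_
    rw [Measure.map_apply hYm (MeasurableSet.univ_pi hs),
      Measure.restrict_apply (hYm (MeasurableSet.univ_pi hs))]
    have := h.law T x (fun t => if ht : t < T + 1 then s ⟨t, ht⟩ else Set.univ) (by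
      intro t
      split_ifs
      · exact hs _
      · exact MeasurableSet.univ)
    have hset : ((fun ω (t : Fin (T + 1)) => Y t ω) ⁻¹' Set.univ.pi s ∩
        {ω | ∀ t ∈ range (T + 1), X t ω = x t}) =
        {ω | ∀ t ∈ range (T + 1), X t ω = x t ∧
          Y t ω ∈ (fun t => if ht : t < T + 1 then s ⟨t, ht⟩ else Set.univ) t} := by
      ext ω
      simp only [Set.mem_inter_iff, Set.mem_preimage, Set.mem_pi, Set.mem_univ, true_implies,
        mem_range, Set.mem_ofPred_eq]
      constructor
      · rintro ⟨h1, h2⟩ t ht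
        refine ⟨h2 t ht, ?_⟩
        simp only [ht, dif_pos]
        exact h1 ⟨t, ht⟩
      · intro h3
        refine ⟨fun t => ?_, fun t ht => (h3 t ht).1⟩
        simpa [t.is_le] using (h3 t t.2).2
    rw [hset, this]
    simp only [Measure.smul_apply, smul_eq_mul, prod_mul_distrib]
    congr 1
    · rw [Fin.prod_univ_succ, prod_range]
      simp [c]
    · rw [prod_range]
      refine prod_congr rfl fun t _ => ?_
      simp [t.is_le]
  have hint : ∫ ω in {ω | ∀ t ∈ range (T + 1), X t ω = x t},
      ∏ t ∈ range (T + 1), φ t (Y t ω) ∂P =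
      ∫ y : Fin (T + 1) → 𝒴, ∏ t : Fin (T + 1), φ t (y t) ∂(Measure.pi fun t : Fin (T + 1) => c t • Q (x t)) := by
    rw [hpi, integral_map hYm.aemeasurable]
    · simp only [prod_range]
    · refine Measurable.aestronglyMeasurable ?_
      exact Finset.measurable_prod _ fun t _ => (hφ t).comp (measurable_pi_apply t)
  rw [hint, integral_fintype_prod_eq_prod (fun (t : Fin (T + 1)) y => φ t y)]
  simp only [integral_smul_measure, smul_eq_mul, prod_mul_distrib]
  congr 1
  · rw [Fin.prod_univ_succ, prod_range]
    simp [c, hp₀, hA]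
  · rw [prod_range]

theorem IsHMM.occupation_zero (h : IsHMM P A p₀ Q X Y) (hA : ∀ i j, 0 ≤ A i j)
    (hp₀ : ∀ i, 0 ≤ p₀ i) {ψ : 𝒴 → ℝ} (hψ : Measurable ψ) (i : Fin n) :
    occupation P X (fun ω => ψ (Y 0 ω)) 0 i = (∫ y, ψ y ∂(Q i)) * p₀ i := by
  have := h.setIntegral_path_prod hA hp₀ 0 (fun _ => i) (φ := fun _ => ψ) (fun _ => hψ)
  simp only [zero_add, range_one, mem_singleton, forall_eq, prod_singleton, range_zero,
    prod_empty, mul_one] at this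
  rw [occupation, this, mul_comm]

variable [IsProbabilityMeasure P]

theorem IsPastProduct.measurable {s : ℕ} {U : Ω → ℝ} (hY : ∀ t, Measurable (Y t))
    (hU : IsPastProduct Y s U) : Measurable U := by
  obtain ⟨φ, hm, -, rfl⟩ := hU
  exact Finset.measurable_prod _ fun t _ => (hm t).comp (hY t)

theorem IsPastProduct.integrable {s : ℕ} {U : Ω → ℝ} (hY : ∀ t, Measurable (Y t))
    (hU : IsPastProduct Y s U) : Integrable U P := by
  obtain ⟨C, hC⟩ := hU.exists_bound
  exact Integrable.of_bound (hU.measurable hY).aestronglyMeasurable C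
    (ae_of_all _ fun ω => hC ω)

/-- The Markov property: one more step of the chain and one more output. -/
theorem IsHMM.occupation_succ (h : IsHMM P A p₀ Q X Y) (hA : ∀ i j, 0 ≤ A i j)
    (hp₀ : ∀ i, 0 ≤ p₀ i) {s : ℕ} {U : Ω → ℝ} (hU : IsPastProduct Y s U) {ψ : 𝒴 → ℝ}
    (hψ : Measurable ψ) (hb : ∃ C, ∀ y, |ψ y| ≤ C) (i : Fin n) :
    occupation P X (fun ω => U ω * ψ (Y (s + 1) ω)) (s + 1) i =
      (∫ y, ψ y ∂(Q i)) * A.mulVec (occupation P X U s) i := by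
  have hint := (hU.mul_output hψ hb).integrable (P := P) h.measurable_output
  have hintU := hU.integrable (P := P) h.measurable_output
  obtain ⟨φ, hm, hφ, rfl⟩ := hU
  -- The path `x` up to time `s`, continued by the state `i`. Summing over all `x` reduces the claim
  -- to path events, where the law is explicit.
  let ext : (Fin (s + 1) → Fin n) → ℕ → Fin n := fun x t => if ht : t < s + 1 then x ⟨t, ht⟩ else i
  let path : (Fin (s + 1) → Fin n) → Set Ω := fun x => {ω | ∀ t : Fin (s + 1), X t ω = x t}
  have hpath : ∀ x, MeasurableSet (path x) := fun x => by
    have : path x = ⋂ t : Fin (s + 1), X t ⁻¹' {x t} := by ext; simp [path]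
    rw [this]
    exact MeasurableSet.iInter fun t => h.measurable_hidden t (measurableSet_singleton _)
  have hdisj : Pairwise (Function.onFun Disjoint path) := by
    intro x x' hx
    refine Set.disjoint_left.2 fun ω h1 h2 => hx ?_
    ext1 t
    exact (h1 t).symm.trans (h2 t)
  have split : ∀ (S : Set Ω) (V : Ω → ℝ), MeasurableSet S → Integrable V P →
      ∫ ω in S, V ω ∂P = ∑ x, ∫ ω in S ∩ path x, V ω ∂P := by
    intro S V hS hV
    rw [← integral_iUnion_fintype (fun x => hS.inter (hpath x))
      (fun x x' hx => (hdisj hx).mono Set.inter_subset_right Set.inter_subset_right)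
      (fun x => hV.integrableOn), ← Set.inter_iUnion]
    have : (⋃ x, path x) = Set.univ := by
      refine Set.eq_univ_of_forall fun ω => Set.mem_iUnion.2 ⟨fun t => X t ω, fun t => rfl⟩
    rw [this, Set.inter_univ]
  have hset1 : ∀ x, {ω | X (s + 1) ω = i} ∩ path x =
      {ω | ∀ t ∈ range (s + 1 + 1), X t ω = ext x t} := by
    intro x
    ext ω
    simp only [Set.mem_inter_iff, Set.mem_ofPred_eq, path, mem_range, ext]
    constructor
    · rintro ⟨h1, h2⟩ t ht
      split_ifs with hts
      · exact h2 ⟨t, hts⟩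
      · have : t = s + 1 := by omega
        rw [this, h1]
    · intro h3
      refine ⟨by simpa using h3 (s + 1) (by omega), fun t => ?_⟩
      simpa [t.is_le] using h3 t (by omega)
  have hset2 : ∀ x, path x = {ω | ∀ t ∈ range (s + 1), X t ω = ext x t} := by
    intro x
    ext ω
    simp only [Set.mem_ofPred_eq, path, mem_range, ext]
    constructor
    · intro h2 t ht
      rw [dif_pos ht]
      exact h2 ⟨t, ht⟩
    · intro h3 t
      simpa [t.is_le] using h3 t t.2
  let J : (Fin (s + 1) → Fin n) → ℝ := fun x => ∫ ω in path x, ∏ t ∈ range (s + 1), φ t (Y t ω) ∂P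
  have hstep : ∀ x, ∫ ω in {ω | X (s + 1) ω = i} ∩ path x,
      (∏ t ∈ range (s + 1), φ t (Y t ω)) * ψ (Y (s + 1) ω) ∂P =
      (∫ y, ψ y ∂(Q i)) * (A i (x (Fin.last s)) * J x) := by
    intro x
    have e1 := h.setIntegral_path_prod hA hp₀ (s + 1) (ext x)
      (φ := fun t => if t = s + 1 then ψ else φ t) (fun t => by
        split_ifs
        exacts [hψ, hm t])
    have e2 := h.setIntegral_path_prod hA hp₀ s (ext x) hm
    have hl : ∀ (g : ℕ → ℝ) (g' : ℕ → ℝ), (∀ t < s + 1, g t = g' t) →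
        ∏ t ∈ range (s + 1), g t = ∏ t ∈ range (s + 1), g' t :=
      fun g g' hg => prod_congr rfl fun t ht => hg t (mem_range.1 ht)
    have el : ext x (s + 1) = i := by simp [ext]
    have el' : ext x s = x (Fin.last s) := by simp [ext, Fin.last]
    rw [hset1]
    simp only [J, hset2]
    rw [e2]
    have e3 : ∀ ω, ∏ t ∈ range (s + 1 + 1), (if t = s + 1 then ψ else φ t) (Y t ω) =
        (∏ t ∈ range (s + 1), φ t (Y t ω)) * ψ (Y (s + 1) ω) := by
      intro ω
      rw [prod_range_succ _ (s + 1), if_pos rfl]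
      congr 1
      exact hl _ _ fun t ht => by rw [if_neg (by omega)]
    simp only [e3] at e1
    rw [e1, prod_range_succ _ s, prod_range_succ _ (s + 1), el, el', if_pos rfl]
    rw [hl _ (fun t => ∫ y, φ t y ∂(Q (ext x t))) fun t ht => by rw [if_neg (by omega)]]
    ring
  have hocc : ∀ j, occupation P X (fun ω => ∏ t ∈ range (s + 1), φ t (Y t ω)) s j =
      ∑ x, if x (Fin.last s) = j then J x else 0 := by
    intro j
    rw [occupation, split {ω | X s ω = j} _ (h.measurable_hidden s (measurableSet_singleton j)) hintU]
    refine sum_congr rfl fun x _ => ?_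
    split_ifs with hx
    · have : {ω | X s ω = j} ∩ path x = path x :=
        Set.inter_eq_right.2 fun ω hω => (hω (Fin.last s)).trans hx
      rw [this]
    · have : {ω | X s ω = j} ∩ path x = ∅ := by
        refine Set.eq_empty_of_forall_notMem fun ω hω => hx ?_
        exact (hω.2 (Fin.last s)).symm.trans hω.1
      rw [this]
      simp
  rw [occupation, split {ω | X (s + 1) ω = i} _
    (h.measurable_hidden (s + 1) (measurableSet_singleton i)) hint]
  simp only [hstep]
  rw [← mul_sum]
  congr 1
  simp only [Matrix.mulVec, dotProduct, hocc, mul_sum]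
  rw [sum_comm]
  refine sum_congr rfl fun x _ => ?_
  simp

/-- `r` steps of the chain without output. -/
theorem IsHMM.occupation_add (h : IsHMM P A p₀ Q X Y) (hA : ∀ i j, 0 ≤ A i j)
    (hp₀ : ∀ i, 0 ≤ p₀ i) {s : ℕ} {U : Ω → ℝ} (hU : IsPastProduct Y s U) (r : ℕ) :
    IsPastProduct Y (s + r) U ∧
      occupation P X U (s + r) = (A ^ r).mulVec (occupation P X U s) := by
  induction r with
  | zero => simpa using hU
  | succ r ih =>
    have hb : ∃ C : ℝ, ∀ y : 𝒴, |(fun _ => 1 : 𝒴 → ℝ) y| ≤ C := ⟨1, fun _ => by simp⟩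
    have hp := ih.1.mul_output (ψ := fun _ => 1) measurable_const hb
    have ho := fun i => h.occupation_succ hA hp₀ ih.1 (ψ := fun _ => 1) measurable_const hb i
    simp only [mul_one] at hp ho
    refine ⟨hp, ?_⟩
    ext i
    rw [← add_assoc, ho, ih.2, pow_succ']
    simp

/-- The law of the hidden state and one output. -/
theorem IsHMM.occupation_output (h : IsHMM P A p₀ Q X Y) (hA : ∀ i j, 0 ≤ A i j)
    (hp₀ : ∀ i, 0 ≤ p₀ i) {ψ : 𝒴 → ℝ} (hψ : Measurable ψ) (hb : ∃ C, ∀ y, |ψ y| ≤ C) (s : ℕ)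
    (i : Fin n) :
    occupation P X (fun ω => ψ (Y s ω)) s i =
      (∫ y, ψ y ∂(Q i)) * (A ^ s).mulVec p₀ i := by
  cases s with
  | zero => simpa using h.occupation_zero hA hp₀ hψ i
  | succ s =>
    have h0 : occupation P X (fun _ => 1) 0 = p₀ := by
      ext j
      simpa using h.occupation_zero hA hp₀ (ψ := fun _ => 1) measurable_const j
    have h1 := h.occupation_add hA hp₀ (isPastProduct_one 0) s
    rw [zero_add, h0] at h1
    have := h.occupation_succ hA hp₀ h1.1 hψ hb i
    simp only [one_mul] at this
    rw [this, h1.2, pow_succ', ← Matrix.mulVec_mulVec]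

end Moments

/-! ### The hidden chain: stochasticity and ergodicity -/

section Chain

open Finset

variable {n : ℕ} {A : Matrix (Fin n) (Fin n) ℝ}

theorem IsColStochastic.sum_mulVec (hA : IsColStochastic A) (v : Fin n → ℝ) :
    ∑ i, A.mulVec v i = ∑ i, v i := by
  simp only [Matrix.mulVec, dotProduct]
  rw [sum_comm]
  simp [← sum_mul, hA.2]

theorem IsColStochastic.mulVec_nonneg (hA : IsColStochastic A) {v : Fin n → ℝ}
    (hv : ∀ i, 0 ≤ v i) (i : Fin n) : 0 ≤ A.mulVec v i := by
  rw [Matrix.mulVec, dotProduct]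
  exact sum_nonneg fun j _ => mul_nonneg (hA.1 i j) (hv j)

theorem IsColStochastic.pow_mulVec_mem (hA : IsColStochastic A) {v : Fin n → ℝ}
    (hv : v ∈ stdSimplex ℝ (Fin n)) (t : ℕ) : (A ^ t).mulVec v ∈ stdSimplex ℝ (Fin n) := by
  induction t with
  | zero => simpa using hv
  | succ t ih =>
    rw [pow_succ', ← Matrix.mulVec_mulVec]
    exact ⟨hA.mulVec_nonneg ih.1, by rw [hA.sum_mulVec, ih.2]⟩

/-- Geometric ergodicity for nonnegative vectors of arbitrary mass. -/
theorem sum_abs_pow_mulVec_sub_le {π : Fin n → ℝ} {G ψ : ℝ}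
    (hG : ∀ p ∈ stdSimplex ℝ (Fin n), ∀ t : ℕ,
      ∑ i, |((A ^ t).mulVec p) i - π i| ≤ 2 * G * ψ ^ t)
    {u : Fin n → ℝ} (hu : ∀ i, 0 ≤ u i) (t : ℕ) :
    ∑ i, |((A ^ t).mulVec u) i - (∑ j, u j) * π i| ≤ (∑ j, u j) * (2 * G * ψ ^ t) := by
  rcases (sum_nonneg fun j (_ : j ∈ univ) => hu j).eq_or_lt with h0 | h0
  · have : u = 0 := by
      ext j
      exact (sum_eq_zero_iff_of_nonneg fun j _ => hu j).1 h0.symm j (mem_univ j)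
    simp [this]
  · set m := ∑ j, u j
    have hp : m⁻¹ • u ∈ stdSimplex ℝ (Fin n) := by
      refine ⟨fun i => mul_nonneg (inv_nonneg.2 h0.le) (hu i), ?_⟩
      simp only [Pi.smul_apply, smul_eq_mul, ← mul_sum]
      exact inv_mul_cancel₀ h0.ne'
    have hu' : u = m • (m⁻¹ • u) := by rw [smul_smul, mul_inv_cancel₀ h0.ne', one_smul]
    calc ∑ i, |((A ^ t).mulVec u) i - m * π i|
        = m * ∑ i, |((A ^ t).mulVec (m⁻¹ • u)) i - π i| := by
          rw [mul_sum]
          refine sum_congr rfl fun i _ => ?_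
          conv_lhs => rw [hu', Matrix.mulVec_smul, Pi.smul_apply, smul_eq_mul, ← mul_sub, abs_mul,
            abs_of_pos h0]
      _ ≤ m * (2 * G * ψ ^ t) := mul_le_mul_of_nonneg_left (hG _ hp t) h0.le

/-- The chain forgets its initial distribution. -/
theorem tendsto_pow_mulVec {π : Fin n → ℝ} (hgeo : IsGeometricallyErgodic A π) {p : Fin n → ℝ}
    (hp : p ∈ stdSimplex ℝ (Fin n)) (i : Fin n) :
    Tendsto (fun t => (A ^ t).mulVec p i) atTop (𝓝 (π i)) := by
  obtain ⟨G, ψ, h0, h1, hG⟩ := hgeo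
  rw [tendsto_iff_norm_sub_tendsto_zero]
  refine squeeze_zero (fun _ => norm_nonneg _) (fun t => ?_)
    (by simpa using (tendsto_pow_atTop_nhds_zero_of_lt_one h0 h1).const_mul (2 * G))
  exact (single_le_sum (f := fun i => |(A ^ t).mulVec p i - π i|)
    (fun _ _ => abs_nonneg _) (mem_univ i)).trans (hG p hp t)

end Chain

/-! ### Means and covariances of consecutive outputs -/

section PairMean

open Finset ProbabilityTheory

variable {n : ℕ} {Ω 𝒴 : Type*} [MeasurableSpace 𝒴]

/-- The mean of `a y * b y'` for consecutive outputs `y`, `y'` when the hidden state at the first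
of the two times has distribution `v`. -/
noncomputable def pairMean (A : Matrix (Fin n) (Fin n) ℝ) (Q : Fin n → Measure 𝒴) (a b : 𝒴 → ℝ)
    (v : Fin n → ℝ) : ℝ :=
  ∑ i, ∑ j, v j * (∫ y, a y ∂(Q j)) * (∫ y, b y ∂(Q i)) * A i j

variable {A : Matrix (Fin n) (Fin n) ℝ} {Q : Fin n → Measure 𝒴}

/-- The functional `a` enters only through its first moments, so the bound is uniform over
truncations of an integrable function. -/
theorem abs_pairMean_le (hA : IsColStochastic A) {a b : 𝒴 → ℝ} {H : ℝ}
    (ha : ∀ i, |∫ y, a y ∂(Q i)| ≤ H) (hb : ∀ i, |∫ y, b y ∂(Q i)| ≤ 1) (v : Fin n → ℝ) :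
    |pairMean A Q a b v| ≤ H * ∑ j, |v j| := by
  calc |pairMean A Q a b v|
      ≤ ∑ i, ∑ j, |v j * (∫ y, a y ∂(Q j)) * (∫ y, b y ∂(Q i)) * A i j| :=
        (abs_sum_le_sum_abs _ _).trans (sum_le_sum fun i _ => abs_sum_le_sum_abs _ _)
    _ ≤ ∑ i, ∑ j, |v j| * H * 1 * A i j := by
        refine sum_le_sum fun i _ => sum_le_sum fun j _ => ?_
        rw [abs_mul, abs_mul, abs_mul, abs_of_nonneg (hA.1 i j)]
        have := hA.1 i j
        have hH := (abs_nonneg _).trans (ha j)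
        gcongr
        exacts [ha j, hb i]
    _ = H * ∑ j, |v j| := by
        rw [sum_comm]
        simp only [← mul_sum, hA.2, mul_one]
        rw [← sum_mul, mul_comm]

theorem pairMean_sub_smul (a b : 𝒴 → ℝ) (u v : Fin n → ℝ) (m : ℝ) :
    pairMean A Q a b (u - m • v) = pairMean A Q a b u - m * pairMean A Q a b v := by
  simp only [pairMean, mul_sum, ← sum_sub_distrib]
  refine sum_congr rfl fun i _ => sum_congr rfl fun j _ => ?_
  simp only [Pi.sub_apply, Pi.smul_apply, smul_eq_mul]
  ring

variable [∀ i, IsProbabilityMeasure (Q i)] [MeasurableSpace Ω] {P : Measure Ω} [IsProbabilityMeasure P] {p₀ : Fin n → ℝ}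
  {X : ℕ → Ω → Fin n} {Y : ℕ → Ω → 𝒴}

theorem IsHMM.integral_output (h : IsHMM P A p₀ Q X Y) (hA : IsColStochastic A)
    (hp₀ : p₀ ∈ stdSimplex ℝ (Fin n)) {ψ : 𝒴 → ℝ} (hψ : Measurable ψ) (hb : ∃ C, ∀ y, |ψ y| ≤ C)
    (s : ℕ) : ∫ ω, ψ (Y s ω) ∂P = ∑ i, (∫ y, ψ y ∂(Q i)) * (A ^ s).mulVec p₀ i := by
  rw [← sum_occupation h.measurable_hidden
    ((isPastProduct_output hψ hb s).integrable h.measurable_output) s]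
  exact sum_congr rfl fun i _ => h.occupation_output hA.1 hp₀.1 hψ hb s i

/-- State probabilities are at most one, which gives a bound uniform in time without stationarity.
-/
theorem IsHMM.integral_output_le (h : IsHMM P A p₀ Q X Y) (hA : IsColStochastic A)
    (hp₀ : p₀ ∈ stdSimplex ℝ (Fin n)) {ψ : 𝒴 → ℝ} (hψ : Measurable ψ) (hb : ∃ C, ∀ y, |ψ y| ≤ C)
    (hnn : ∀ y, 0 ≤ ψ y) (s : ℕ) : ∫ ω, ψ (Y s ω) ∂P ≤ ∑ i, ∫ y, ψ y ∂(Q i) := by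
  rw [h.integral_output hA hp₀ hψ hb]
  refine sum_le_sum fun i _ => mul_le_of_le_one_right (integral_nonneg hnn) ?_
  have := hA.pow_mulVec_mem hp₀ s
  rw [← this.2]
  exact single_le_sum (fun j _ => this.1 j) (mem_univ i)

theorem IsHMM.integral_pair (h : IsHMM P A p₀ Q X Y) (hA : IsColStochastic A)
    (hp₀ : p₀ ∈ stdSimplex ℝ (Fin n)) {a b : 𝒴 → ℝ} (ha : Measurable a) (hb : Measurable b)
    (ha' : ∃ C, ∀ y, |a y| ≤ C) (hb' : ∃ C, ∀ y, |b y| ≤ C) (s : ℕ) :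
    ∫ ω, a (Y s ω) * b (Y (s + 1) ω) ∂P = pairMean A Q a b ((A ^ s).mulVec p₀) := by
  have hU : IsPastProduct Y s fun ω => a (Y s ω) := isPastProduct_output ha ha' s
  rw [← sum_occupation h.measurable_hidden
    ((hU.mul_output hb hb').integrable h.measurable_output) (s + 1)]
  refine sum_congr rfl fun i _ => ?_
  rw [h.occupation_succ hA.1 hp₀.1 hU hb hb' i]
  simp only [Matrix.mulVec, dotProduct, mul_sum]
  refine sum_congr rfl fun j _ => ?_
  rw [h.occupation_output hA.1 hp₀.1 ha ha' s j]
  simp only [Matrix.mulVec, dotProduct]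
  ring

/-- The past `U` acts as an unnormalized initial distribution at time `s`, from which the chain runs
`r + 1` steps before the pair is observed. -/
theorem IsHMM.integral_mul_pair (h : IsHMM P A p₀ Q X Y) (hA : IsColStochastic A)
    (hp₀ : p₀ ∈ stdSimplex ℝ (Fin n)) {a b : 𝒴 → ℝ} (ha : Measurable a) (hb : Measurable b)
    (ha' : ∃ C, ∀ y, |a y| ≤ C) (hb' : ∃ C, ∀ y, |b y| ≤ C) {s : ℕ} {U : Ω → ℝ}
    (hU : IsPastProduct Y s U) (r : ℕ) :
    ∫ ω, U ω * (a (Y (s + r + 1) ω) * b (Y (s + r + 2) ω)) ∂P =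
      pairMean A Q a b ((A ^ (r + 1)).mulVec (occupation P X U s)) := by
  obtain ⟨hV, hoV⟩ := h.occupation_add hA.1 hp₀.1 hU r
  have hW := hV.mul_output ha ha'
  simp only [← mul_assoc]
  rw [← sum_occupation h.measurable_hidden
    ((hW.mul_output hb hb').integrable h.measurable_output) (s + r + 2)]
  refine sum_congr rfl fun i _ => ?_
  rw [h.occupation_succ hA.1 hp₀.1 hW hb hb' i]
  rw [Matrix.mulVec, dotProduct, mul_sum]
  refine sum_congr rfl fun j _ => ?_
  rw [h.occupation_succ hA.1 hp₀.1 hV ha ha' j, hoV, pow_succ', ← Matrix.mulVec_mulVec]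
  ring

/-- Geometric decay of the covariances of functionals of consecutive outputs. -/
theorem IsHMM.abs_covariance_le (h : IsHMM P A p₀ Q X Y) (hA : IsColStochastic A)
    (hp₀ : p₀ ∈ stdSimplex ℝ (Fin n)) {π : Fin n → ℝ} {G ψ : ℝ} (hψ0 : 0 ≤ ψ) (hψ1 : ψ < 1)
    (hG : ∀ p ∈ stdSimplex ℝ (Fin n), ∀ t : ℕ,
      ∑ i, |((A ^ t).mulVec p) i - π i| ≤ 2 * G * ψ ^ t)
    {a : ℕ → 𝒴 → ℝ} {b : 𝒴 → ℝ} {H : ℝ} (ha : ∀ t, Measurable (a t)) (hb : Measurable b)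
    (ha0 : ∀ t y, 0 ≤ a t y) (ha' : ∀ t, ∃ C, ∀ y, |a t y| ≤ C)
    (haH : ∀ t i, ∫ y, a t y ∂(Q i) ≤ H) (hb0 : ∀ y, 0 ≤ b y) (hb1 : ∀ y, b y ≤ 1)
    {s t : ℕ} (hst : s < t) :
    |cov[fun ω => a s (Y s ω) * b (Y (s + 1) ω), fun ω => a t (Y t ω) * b (Y (t + 1) ω); P]| ≤
      H ^ 2 * (1 + 4 * G) * ψ ^ (t - s - 1) := by
  have hG0 : 0 ≤ G := by
    have := (sum_nonneg fun i _ => abs_nonneg _).trans (hG p₀ hp₀ 0)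
    simpa using this
  have hb' : ∃ C, ∀ y, |b y| ≤ C := ⟨1, fun y => by rw [abs_of_nonneg (hb0 y)]; exact hb1 y⟩
  have hqb : ∀ i, |∫ y, b y ∂(Q i)| ≤ 1 := fun i => by
    rw [abs_of_nonneg (integral_nonneg hb0)]
    refine (integral_mono_of_nonneg (ae_of_all _ hb0) (integrable_const 1)
      (ae_of_all _ hb1)).trans ?_
    simp
  have hqa : ∀ t i, |∫ y, a t y ∂(Q i)| ≤ H := fun t i => by
    rw [abs_of_nonneg (integral_nonneg (ha0 t))]; exact haH t i
  have hU : ∀ t, IsPastProduct Y (t + 1) fun ω => a t (Y t ω) * b (Y (t + 1) ω) := fun t =>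
    (isPastProduct_output (ha t) (ha' t) t).mul_output hb hb'
  have hL : ∀ t, MemLp (fun ω => a t (Y t ω) * b (Y (t + 1) ω)) 2 P := fun t => by
    obtain ⟨C, hC⟩ := (hU t).exists_bound
    exact MemLp.of_bound ((hU t).measurable h.measurable_output).aestronglyMeasurable C
      (ae_of_all _ hC)
  have hE0 : ∀ t, 0 ≤ ∫ ω, a t (Y t ω) * b (Y (t + 1) ω) ∂P := fun t =>
    integral_nonneg fun ω => mul_nonneg (ha0 t _) (hb0 _)
  have hE1 : ∀ t, ∫ ω, a t (Y t ω) * b (Y (t + 1) ω) ∂P ≤ H := fun t => by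
    rw [h.integral_pair hA hp₀ (ha t) hb (ha' t) hb' t]
    refine (le_abs_self _).trans ((abs_pairMean_le hA (hqa t) hqb _).trans ?_)
    have := hA.pow_mulVec_mem hp₀ t
    simp only [abs_of_nonneg (this.1 _), this.2, mul_one, le_refl]
  have hH0 : 0 ≤ H := (hE0 0).trans (hE1 0)
  rw [covariance_eq_sub (hL s) (hL t)]
  simp only [Pi.mul_apply]
  -- If `t = s + 1`, the two pairs share an output and ergodicity is of no use. Both the mixed
  -- moment and the product of the means lie in `[0, H ^ 2]`, which accounts for the 1 in `1 + 4 *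
  -- G`.
  rcases Nat.lt_iff_add_one_le.1 hst |>.eq_or_lt with rfl | hlt
  · have hba : ∃ C, ∀ y, |b y * a (s + 1) y| ≤ C := by
      obtain ⟨C, hC⟩ := ha' (s + 1)
      refine ⟨C, fun y => ?_⟩
      rw [abs_mul, abs_of_nonneg (hb0 y)]
      exact (mul_le_of_le_one_left (abs_nonneg _) (hb1 y)).trans (hC y)
    have hup : ∫ ω, a s (Y s ω) * b (Y (s + 1) ω) *
        (a (s + 1) (Y (s + 1) ω) * b (Y (s + 1 + 1) ω)) ∂P ≤ H ^ 2 := by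
      have hV := (isPastProduct_output (Y := Y) (ha s) (ha' s) s).mul_output (ha (s + 1))
        (ha' (s + 1))
      refine (integral_mono_of_nonneg (ae_of_all _ fun ω => ?_)
        (hV.integrable h.measurable_output) (ae_of_all _ fun ω => ?_)).trans ?_
      · exact mul_nonneg (mul_nonneg (ha0 _ _) (hb0 _)) (mul_nonneg (ha0 _ _) (hb0 _))
      · have h1 := ha0 s (Y s ω)
        have h2 := ha0 (s + 1) (Y (s + 1) ω)
        calc a s (Y s ω) * b (Y (s + 1) ω) * (a (s + 1) (Y (s + 1) ω) * b (Y (s + 1 + 1) ω))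
            ≤ a s (Y s ω) * 1 * (a (s + 1) (Y (s + 1) ω) * 1) := by
              have := hb0 (Y (s + 1) ω)
              have := hb0 (Y (s + 1 + 1) ω)
              gcongr
              exacts [hb1 _, hb1 _]
          _ = a s (Y s ω) * a (s + 1) (Y (s + 1) ω) := by ring
      · rw [← sum_occupation h.measurable_hidden (hV.integrable h.measurable_output) (s + 1)]
        calc ∑ i, occupation P X (fun ω => a s (Y s ω) * a (s + 1) (Y (s + 1) ω)) (s + 1) i
            ≤ ∑ i, H * A.mulVec (fun j => H * (A ^ s).mulVec p₀ j) i := by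
              refine sum_le_sum fun i _ => ?_
              have hs := hA.pow_mulVec_mem hp₀ s
              rw [h.occupation_succ hA.1 hp₀.1 (isPastProduct_output (ha s) (ha' s) s)
                (ha (s + 1)) (ha' (s + 1)) i]
              have key : A.mulVec (occupation P X (fun ω => a s (Y s ω)) s) i ≤
                  A.mulVec (fun j => H * (A ^ s).mulVec p₀ j) i := by
                simp only [Matrix.mulVec, dotProduct]
                refine sum_le_sum fun j _ => mul_le_mul_of_nonneg_left ?_ (hA.1 i j)
                rw [← dotProduct, ← Matrix.mulVec]
                rw [h.occupation_output hA.1 hp₀.1 (ha s) (ha' s)]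
                exact mul_le_mul_of_nonneg_right (haH s j) (hs.1 j)
              refine mul_le_mul (haH _ i) key ?_ hH0
              refine hA.mulVec_nonneg (fun j => ?_) i
              rw [h.occupation_output hA.1 hp₀.1 (ha s) (ha' s)]
              exact mul_nonneg (integral_nonneg (ha0 s)) (hs.1 j)
          _ = H ^ 2 := by
              rw [← mul_sum, hA.sum_mulVec, ← mul_sum, (hA.pow_mulVec_mem hp₀ s).2]
              ring
    have hlo : 0 ≤ ∫ ω, a s (Y s ω) * b (Y (s + 1) ω) *
        (a (s + 1) (Y (s + 1) ω) * b (Y (s + 1 + 1) ω)) ∂P :=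
      integral_nonneg fun ω =>
        mul_nonneg (mul_nonneg (ha0 _ _) (hb0 _)) (mul_nonneg (ha0 _ _) (hb0 _))
    have hprod : (∫ ω, a s (Y s ω) * b (Y (s + 1) ω) ∂P) *
        (∫ ω, a (s + 1) (Y (s + 1) ω) * b (Y (s + 1 + 1) ω) ∂P) ≤ H ^ 2 := by
      rw [sq]
      exact mul_le_mul (hE1 s) (hE1 (s + 1)) (hE0 _) hH0
    have hprod0 := mul_nonneg (hE0 s) (hE0 (s + 1))
    have hsimp : s + 1 - s - 1 = 0 := by omega
    rw [hsimp, pow_zero, mul_one]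
    have : 0 ≤ H ^ 2 * (4 * G) := by positivity
    rw [abs_le]
    constructor <;> linarith
  · obtain ⟨r, rfl⟩ := Nat.exists_eq_add_of_lt hlt
    set u := occupation P X (fun ω => a s (Y s ω) * b (Y (s + 1) ω)) (s + 1) with hu
    have hu0 : ∀ i, 0 ≤ u i := fun i =>
      integral_nonneg fun ω => mul_nonneg (ha0 _ _) (hb0 _)
    have hsum : ∫ ω, a s (Y s ω) * b (Y (s + 1) ω) ∂P = ∑ i, u i :=
      (sum_occupation h.measurable_hidden ((hU s).integrable h.measurable_output) (s + 1)).symm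
    have e1 := h.integral_mul_pair hA hp₀ (ha (s + 1 + r + 1)) hb (ha' _) hb' (hU s) r
    have e2 := h.integral_pair hA hp₀ (ha (s + 1 + r + 1)) hb (ha' _) hb' (s + 1 + r + 1)
    have hm := hE1 s
    have hm0 := hE0 s
    rw [hsum] at hm hm0
    -- By linearity the covariance is `pairMean` of a difference of two vectors. With `m = ∑ i, u
    -- i`, each is within `m * (2 * G * ψ ^ (r + 1))` of `m • π` in the 1-norm.
    rw [e1, e2, hsum, ← pairMean_sub_smul]
    refine (abs_pairMean_le hA (hqa _) hqb _).trans ?_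
    have d1 := sum_abs_pow_mulVec_sub_le hG hu0 (r + 1)
    have d2 := hG p₀ hp₀ (s + 1 + r + 1)
    have hpow : ψ ^ (s + 1 + r + 1) ≤ ψ ^ (r + 1) :=
      pow_le_pow_of_le_one hψ0 hψ1.le (by omega)
    have hd : ∑ j, |((A ^ (r + 1)).mulVec u - (∑ i, u i) •
        (A ^ (s + 1 + r + 1)).mulVec p₀) j| ≤ H * (4 * G * ψ ^ (r + 1)) := by
      calc _ ≤ ∑ j, (|(A ^ (r + 1)).mulVec u j - (∑ i, u i) * π j| +
            (∑ i, u i) * |(A ^ (s + 1 + r + 1)).mulVec p₀ j - π j|) := by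
            refine sum_le_sum fun j _ => ?_
            simp only [Pi.sub_apply, Pi.smul_apply, smul_eq_mul]
            rw [← abs_of_nonneg hm0, ← abs_mul, abs_of_nonneg hm0]
            refine le_trans (le_of_eq ?_) (abs_sub _ _)
            congr 1
            ring
        _ ≤ (∑ i, u i) * (2 * G * ψ ^ (r + 1)) + (∑ i, u i) * (2 * G * ψ ^ (r + 1)) := by
            rw [sum_add_distrib, ← mul_sum]
            refine add_le_add d1 (mul_le_mul_of_nonneg_left (d2.trans ?_) hm0)
            gcongr
        _ = (∑ i, u i) * (4 * G * ψ ^ (r + 1)) := by ring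
        _ ≤ H * (4 * G * ψ ^ (r + 1)) := by gcongr
    have hsimp : s + 1 + r + 1 - s - 1 = r + 1 := by omega
    rw [hsimp]
    calc _ ≤ H * (H * (4 * G * ψ ^ (r + 1))) := mul_le_mul_of_nonneg_left hd hH0
      _ ≤ H ^ 2 * (1 + 4 * G) * ψ ^ (r + 1) := by
        have : 0 ≤ H ^ 2 * ψ ^ (r + 1) := by positivity
        linarith

end PairMean

/-! ### Strong laws for the outputs -/

section OutputStrongLaw

open Finset ProbabilityTheory

variable {n : ℕ} {Ω 𝒴 : Type*} [MeasurableSpace Ω] [MeasurableSpace 𝒴]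
  {P : Measure Ω} [IsProbabilityMeasure P] {A : Matrix (Fin n) (Fin n) ℝ} {p₀ : Fin n → ℝ}
  {Q : Fin n → Measure 𝒴} [∀ i, IsProbabilityMeasure (Q i)]
  {X : ℕ → Ω → Fin n} {Y : ℕ → Ω → 𝒴}

/-- The outputs exceed the time index only finitely often, for integrable functionals. -/
theorem IsHMM.ae_eventually_le (h : IsHMM P A p₀ Q X Y) (hA : IsColStochastic A)
    (hp₀ : p₀ ∈ stdSimplex ℝ (Fin n)) {a : 𝒴 → ℝ} (ha : Measurable a) (ha0 : ∀ y, 0 ≤ a y)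
    (hint : ∀ i, Integrable a (Q i)) :
    ∀ᵐ ω ∂P, ∀ᶠ t : ℕ in atTop, a (Y t ω) ≤ t := by
  have hS : ∀ t : ℕ, MeasurableSet {y | a y ∈ Set.Ioi (t : ℝ)} := fun t => ha measurableSet_Ioi
  have hle : ∀ t : ℕ, P {ω | a (Y t ω) ∈ Set.Ioi (t : ℝ)} ≤
      ∑ i, Q i {y | a y ∈ Set.Ioi (t : ℝ)} := by
    intro t
    have hmeas : MeasurableSet {ω | a (Y t ω) ∈ Set.Ioi (t : ℝ)} := h.measurable_output t (hS t)
    have := h.integral_output_le hA hp₀ (ψ := Set.indicator {y | a y ∈ Set.Ioi (t : ℝ)} 1)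
      (measurable_one.indicator (hS t))
      ⟨1, fun y => by rw [Set.indicator_apply]; split_ifs <;> simp⟩
      (fun y => Set.indicator_nonneg (fun _ _ => zero_le_one) y) t
    have e : (fun ω => Set.indicator {y | a y ∈ Set.Ioi (t : ℝ)} (1 : 𝒴 → ℝ) (Y t ω)) =
        Set.indicator {ω | a (Y t ω) ∈ Set.Ioi (t : ℝ)} 1 := by
      ext ω
      simp [Set.indicator_apply]
    rw [e, integral_indicator_one hmeas] at this
    simp only [integral_indicator_one (hS t)] at this
    rw [← ENNReal.ofReal_toReal (measure_ne_top P _)]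
    refine (ENNReal.ofReal_le_ofReal this).trans (le_of_eq ?_)
    rw [ENNReal.ofReal_sum_of_nonneg fun _ _ => measureReal_nonneg]
    exact sum_congr rfl fun i _ => ofReal_measureReal
  have hsum : ∑' t : ℕ, P {ω | a (Y t ω) ∈ Set.Ioi (t : ℝ)} ≠ ⊤ := by
    refine ne_top_of_le_ne_top ?_ (ENNReal.tsum_le_tsum hle)
    rw [Summable.tsum_finsetSum fun _ _ => ENNReal.summable]
    refine ENNReal.sum_ne_top.2 fun i _ => ?_
    let _ : MeasureSpace 𝒴 := ⟨Q i⟩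
    exact (tsum_prob_mem_Ioi_lt_top (hint i) ha0).ne
  filter_upwards [ae_eventually_notMem hsum] with ω hω
  filter_upwards [hω] with t ht
  simpa using ht

/-- The strong law of large numbers for `a (Y t) * b (Y (t + 1))`, with `a ≥ 0` integrable with
respect to all emission laws and `0 ≤ b ≤ 1`. -/
theorem IsHMM.ae_tendsto_average (h : IsHMM P A p₀ Q X Y) (hA : IsColStochastic A)
    (hp₀ : p₀ ∈ stdSimplex ℝ (Fin n)) {π : Fin n → ℝ} (hgeo : IsGeometricallyErgodic A π)
    {a b : 𝒴 → ℝ} (ha : Measurable a) (hb : Measurable b) (ha0 : ∀ y, 0 ≤ a y)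
    (hint : ∀ i, Integrable a (Q i)) (hb0 : ∀ y, 0 ≤ b y) (hb1 : ∀ y, b y ≤ 1) :
    ∀ᵐ ω ∂P, Tendsto (fun N : ℕ => (∑ t ∈ range N, a (Y t ω) * b (Y (t + 1) ω)) / N) atTop
      (𝓝 (pairMean A Q a b π)) := by
  obtain ⟨G, ψ, hψ0, hψ1, hG⟩ := id hgeo
  have hG0 : 0 ≤ G := by
    have := (sum_nonneg fun i _ => abs_nonneg _).trans (hG p₀ hp₀ 0)
    simpa using this
  have hb' : ∃ C, ∀ y, |b y| ≤ C := ⟨1, fun y => by rw [abs_of_nonneg (hb0 y)]; exact hb1 y⟩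
  -- At truncation level `t` the second moments, divided by `t ^ 2`, have a sum bounded by twice the
  -- first moment, while only finitely many terms are changed.
  let τ : ℕ → 𝒴 → ℝ := fun t => truncation a t
  have hτm : ∀ t, Measurable (τ t) := fun t =>
    (measurable_id.indicator measurableSet_Ioc).comp ha
  have hτ0 : ∀ t y, 0 ≤ τ t y := fun t y => truncation_nonneg _ (ha0 y)
  have hτb : ∀ t, ∃ C, ∀ y, |τ t y| ≤ C := fun t => ⟨_, abs_truncation_le_bound a t⟩
  set H : ℝ := ∑ i, ∫ y, a y ∂(Q i) with hH
  have hτH : ∀ t i, ∫ y, τ t y ∂(Q i) ≤ H := fun t i =>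
    (integral_truncation_le_integral_of_nonneg (hint i) ha0).trans
      (single_le_sum (f := fun i => ∫ y, a y ∂(Q i)) (fun i _ => integral_nonneg ha0) (mem_univ i))
  let Z : ℕ → Ω → ℝ := fun t ω => τ t (Y t ω) * b (Y (t + 1) ω)
  have hZm : ∀ t, Measurable (Z t) := fun t =>
    ((hτm t).comp (h.measurable_output t)).mul (hb.comp (h.measurable_output (t + 1)))
  have hZb : ∀ t ω, |Z t ω| ≤ |τ t (Y t ω)| := fun t ω => by
    rw [abs_mul, abs_of_nonneg (hb0 _)]
    exact mul_le_of_le_one_right (abs_nonneg _) (hb1 _)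
  have hZL : ∀ t, MemLp (Z t) 2 P := fun t =>
    MemLp.of_bound (hZm t).aestronglyMeasurable |(t : ℝ)|
      (ae_of_all _ fun ω => (hZb t ω).trans (abs_truncation_le_bound a t _))
  have hZ0 : Z 0 = 0 := by
    ext ω
    simp [Z, τ]
  let E : ℝ := H ^ 2 * (1 + 4 * G) / (1 - ψ)
  have hE : 0 ≤ E := by
    have : 0 < 1 - ψ := by linarith
    positivity
  -- Adding `Z t` to the partial sum adds its variance and twice its covariance with all earlier
  -- terms, which a geometric series bounds by `E`. Since `Z 0 = 0`, nothing is needed at time zero.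
  let w : ℕ → ℝ := fun t => if t = 0 then 0 else ∑ i, (∫ y, (τ t y) ^ 2 ∂(Q i)) + 2 * E
  have hvarZ : ∀ t, Var[Z t; P] ≤ ∑ i, ∫ y, (τ t y) ^ 2 ∂(Q i) := by
    intro t
    obtain ⟨C, hC⟩ := hτb t
    refine (variance_le_expectation_sq (hZm t).aestronglyMeasurable).trans ?_
    refine le_trans ?_ (h.integral_output_le hA hp₀ ((hτm t).pow_const 2)
      ⟨C ^ 2, fun y => by rw [abs_pow]; exact pow_le_pow_left₀ (abs_nonneg _) (hC y) 2⟩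
      (fun y => sq_nonneg _) t)
    refine integral_mono_of_nonneg (ae_of_all _ fun ω => sq_nonneg _) ?_
      (ae_of_all _ fun ω => sq_le_sq.2 (hZb t ω))
    refine Integrable.of_bound (((hτm t).pow_const 2).comp
      (h.measurable_output t)).aestronglyMeasurable (C ^ 2) (ae_of_all _ fun ω => ?_)
    rw [Real.norm_eq_abs]
    rw [abs_pow]
    exact pow_le_pow_left₀ (abs_nonneg _) (hC _) 2
  have hcov : ∀ N, cov[∑ s ∈ range N, Z s, Z N; P] ≤ E := by
    intro N
    rw [covariance_sum_left' (fun s _ => hZL s) (hZL N)]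
    calc ∑ s ∈ range N, cov[Z s, Z N; P]
        ≤ ∑ s ∈ range N, H ^ 2 * (1 + 4 * G) * ψ ^ (N - 1 - s) := by
          refine sum_le_sum fun s hs => (le_abs_self _).trans ?_
          have := h.abs_covariance_le hA hp₀ hψ0 hψ1 hG hτm hb hτ0 hτb hτH hb0 hb1
            (mem_range.1 hs)
          rwa [show N - s - 1 = N - 1 - s by omega] at this
      _ = H ^ 2 * (1 + 4 * G) * ∑ s ∈ range N, ψ ^ s := by
          rw [← mul_sum, sum_range_reflect (fun s => ψ ^ s) N]
      _ ≤ H ^ 2 * (1 + 4 * G) * (1 - ψ)⁻¹ := by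
          refine mul_le_mul_of_nonneg_left ?_ (by positivity)
          rw [← tsum_geometric_of_lt_one hψ0 hψ1]
          exact (summable_geometric_of_lt_one hψ0 hψ1).sum_le_tsum _
            fun _ _ => pow_nonneg hψ0 _
      _ = E := by rw [← div_eq_mul_inv]
  have hvar : ∀ N, Var[∑ t ∈ range N, Z t; P] ≤ ∑ t ∈ range N, w t := by
    intro N
    induction N with
    | zero => simp [variance_zero]
    | succ N ih =>
      rcases Nat.eq_zero_or_pos N with rfl | hN
      · simp [hZ0, w, variance_zero]
      · rw [sum_range_succ, sum_range_succ,
          variance_add (memLp_finsetSum' _ fun j _ => hZL j) (hZL N)]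
        simp only [w, hN.ne', if_false]
        have := hcov N
        have := hvarZ N
        simp only [w] at ih
        linarith
  have hw : ∀ t, 0 ≤ w t := fun t => by
    simp only [w]
    split_ifs
    · exact le_rfl
    · have : 0 ≤ ∑ i, ∫ y, (τ t y) ^ 2 ∂(Q i) :=
        sum_nonneg fun i _ => integral_nonneg fun y => sq_nonneg _
      linarith
  have hD : ∀ K, ∑ j ∈ range K, ((j : ℝ) ^ 2)⁻¹ * w j ≤
      2 * H + (∑' j : ℕ, ((j : ℝ) ^ 2)⁻¹) * (2 * E) := by
    intro K
    calc ∑ j ∈ range K, ((j : ℝ) ^ 2)⁻¹ * w j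
        ≤ ∑ j ∈ range K, (∑ i, ((j : ℝ) ^ 2)⁻¹ * (∫ y, (τ j y) ^ 2 ∂(Q i)) +
            ((j : ℝ) ^ 2)⁻¹ * (2 * E)) := by
          refine sum_le_sum fun j _ => ?_
          rw [← mul_sum, ← mul_add]
          refine mul_le_mul_of_nonneg_left ?_ (by positivity)
          simp only [w]
          split_ifs
          · have : 0 ≤ ∑ i, ∫ y, (τ j y) ^ 2 ∂(Q i) :=
              sum_nonneg fun i _ => integral_nonneg fun y => sq_nonneg _
            linarith
          · exact le_rfl
      _ = ∑ i, ∑ j ∈ range K, ((j : ℝ) ^ 2)⁻¹ * (∫ y, (τ j y) ^ 2 ∂(Q i)) +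
            (∑ j ∈ range K, ((j : ℝ) ^ 2)⁻¹) * (2 * E) := by
          rw [sum_add_distrib, sum_comm, sum_mul]
      _ ≤ 2 * H + (∑' j : ℕ, ((j : ℝ) ^ 2)⁻¹) * (2 * E) := by
          refine add_le_add ?_ (mul_le_mul_of_nonneg_right ?_ (by positivity))
          · rw [hH, mul_sum]
            refine sum_le_sum fun i _ => ?_
            let _ : MeasureSpace 𝒴 := ⟨Q i⟩
            exact sum_variance_truncation_le (hint i) ha0 K
          · exact (Real.summable_nat_pow_inv.2 one_lt_two).sum_le_tsum _
              fun _ _ => by positivity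
  have hmean : Tendsto (fun t => P[Z t]) atTop (𝓝 (pairMean A Q a b π)) := by
    have : ∀ t, P[Z t] = pairMean A Q (τ t) b ((A ^ t).mulVec p₀) := fun t =>
      h.integral_pair hA hp₀ (hτm t) hb (hτb t) hb' t
    simp only [this, pairMean]
    refine tendsto_finsetSum _ fun i _ => tendsto_finsetSum _ fun j _ => ?_
    refine Tendsto.mul_const _ (Tendsto.mul_const _ (Tendsto.mul ?_ ?_))
    · exact tendsto_pow_mulVec hgeo hp₀ j
    · exact (tendsto_integral_truncation (hint j)).comp tendsto_natCast_atTop_atTop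
  have hnn : ∀ t ω, 0 ≤ Z t ω := fun t ω => mul_nonneg (hτ0 _ _) (hb0 _)
  filter_upwards [ae_tendsto_sum_div_of_variance_le hZL hnn hw (by simp [w]) hvar hD hmean,
    h.ae_eventually_le hA hp₀ ha ha0 hint] with ω hω hω'
  -- Along this outcome truncation is eventually inactive, so it does not affect the limit of the
  -- averages.
  have heq : ∀ᶠ t : ℕ in atTop, a (Y t ω) * b (Y (t + 1) ω) - Z t ω = 0 := by
    filter_upwards [hω', eventually_gt_atTop 0] with t ht ht0
    have : τ t (Y t ω) = a (Y t ω) := by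
      have : a (Y t ω) ∈ Set.Ioc (-(t : ℝ)) t :=
        ⟨lt_of_lt_of_le (by simpa using ht0) (ha0 _), ht⟩
      simp only [τ, truncation, Function.comp_apply, Set.indicator_of_mem this, id]
    simp only [Z, this, sub_self]
  have hdiff := (Asymptotics.isLittleO_sum_range_of_tendsto_zero
    (tendsto_const_nhds.congr' (heq.mono fun t ht => ht.symm))).tendsto_div_nhds_zero
  have := hω.add hdiff
  rw [add_zero] at this
  refine this.congr fun N => ?_
  rw [← add_div, ← sum_add_distrib]
  simp only [add_sub_cancel]

/-- The strong law of large numbers for `a (Y t)`. -/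
theorem IsHMM.ae_tendsto_average_single (h : IsHMM P A p₀ Q X Y) (hA : IsColStochastic A)
    (hp₀ : p₀ ∈ stdSimplex ℝ (Fin n)) {π : Fin n → ℝ} (hgeo : IsGeometricallyErgodic A π)
    {a : 𝒴 → ℝ} (ha : Measurable a) (ha0 : ∀ y, 0 ≤ a y) (hint : ∀ i, Integrable a (Q i)) :
    ∀ᵐ ω ∂P, Tendsto (fun N : ℕ => 1 / (N : ℝ) * ∑ t ∈ range N, a (Y t ω)) atTop
      (𝓝 (∑ j, (∫ y, a y ∂(Q j)) * π j)) := by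
  have hlim : pairMean A Q a (fun _ => 1) π = ∑ j, (∫ y, a y ∂(Q j)) * π j := by
    rw [pairMean, sum_comm]
    refine sum_congr rfl fun j _ => ?_
    simp [← sum_mul, hA.2, mul_comm]
  have := h.ae_tendsto_average hA hp₀ hgeo ha (b := fun _ => 1) measurable_const ha0 hint
    (fun _ => zero_le_one) (fun _ => le_rfl)
  simpa [hlim, div_eq_inv_mul] using this

/-- The strong law of large numbers in the normalization `1 / (T - 1)`. -/
theorem IsHMM.ae_tendsto_average_pair (h : IsHMM P A p₀ Q X Y) (hA : IsColStochastic A)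
    (hp₀ : p₀ ∈ stdSimplex ℝ (Fin n)) {π : Fin n → ℝ} (hgeo : IsGeometricallyErgodic A π)
    {a b : 𝒴 → ℝ} (ha : Measurable a) (hb : Measurable b) (ha0 : ∀ y, 0 ≤ a y)
    (hint : ∀ i, Integrable a (Q i)) (hb0 : ∀ y, 0 ≤ b y) (hb1 : ∀ y, b y ≤ 1) :
    ∀ᵐ ω ∂P, Tendsto (fun T : ℕ => 1 / ((T : ℝ) - 1) *
      ∑ t ∈ Ico 1 T, a (Y (t - 1) ω) * b (Y t ω)) atTop (𝓝 (pairMean A Q a b π)) := by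
  filter_upwards [h.ae_tendsto_average hA hp₀ hgeo ha hb ha0 hint hb0 hb1] with ω hω
  -- With `T = N + 1` the `T - 1` pairs are exactly the first `N` terms.
  rw [← tendsto_add_atTop_iff_nat 1]
  refine hω.congr fun N => ?_
  rw [sum_Ico_eq_sum_range]
  simp only [add_tsub_cancel_right, add_tsub_cancel_left, Nat.cast_add, Nat.cast_one]
  rw [div_eq_inv_mul, one_div]
  simp only [add_comm 1]

/-- If the limit mean vanishes, then all terms vanish almost surely. -/
theorem IsHMM.ae_eq_zero_of_pairMean_eq_zero (h : IsHMM P A p₀ Q X Y) (hA : IsColStochastic A)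
    (hp₀ : p₀ ∈ stdSimplex ℝ (Fin n)) {π : Fin n → ℝ} (hπ : ∀ i, 0 < π i)
    {a b : 𝒴 → ℝ} (ha : Measurable a) (hb : Measurable b) (ha0 : ∀ y, 0 ≤ a y)
    (ha1 : ∀ y, a y ≤ 1) (hb0 : ∀ y, 0 ≤ b y) (hb1 : ∀ y, b y ≤ 1)
    (hzero : pairMean A Q a b π = 0) :
    ∀ᵐ ω ∂P, ∀ t, a (Y t ω) * b (Y (t + 1) ω) = 0 := by
  rw [ae_all_iff]
  intro t
  have ha' : ∃ C, ∀ y, |a y| ≤ C := ⟨1, fun y => by rw [abs_of_nonneg (ha0 y)]; exact ha1 y⟩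
  have hb' : ∃ C, ∀ y, |b y| ≤ C := ⟨1, fun y => by rw [abs_of_nonneg (hb0 y)]; exact hb1 y⟩
  have hE := h.integral_pair hA hp₀ ha hb ha' hb' t
  have hnn : ∀ i j, 0 ≤ π j * (∫ y, a y ∂(Q j)) * (∫ y, b y ∂(Q i)) * A i j := fun i j =>
    mul_nonneg (mul_nonneg (mul_nonneg (hπ j).le (integral_nonneg ha0)) (integral_nonneg hb0))
      (hA.1 i j)
  -- All summands at `π` are nonnegative and `π j > 0`, so another factor of each summand vanishes;
  -- the mean is then zero for every distribution of the hidden state.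
  have hz : pairMean A Q a b ((A ^ t).mulVec p₀) = 0 := by
    refine sum_eq_zero fun i _ => sum_eq_zero fun j _ => ?_
    have h1 := (sum_eq_zero_iff_of_nonneg fun i _ => sum_nonneg fun j _ => hnn i j).1 hzero i
      (mem_univ i)
    have h2 := (sum_eq_zero_iff_of_nonneg fun j _ => hnn i j).1 h1 j (mem_univ j)
    have := (hπ j).ne'
    simp only [mul_eq_zero] at h2 ⊢
    tauto
  rw [hz, integral_eq_zero_iff_of_nonneg (fun ω => mul_nonneg (ha0 _) (hb0 _))
    (((isPastProduct_output ha ha' t).mul_output hb hb').integrable h.measurable_output)] at hE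
  exact hE

end OutputStrongLaw

/-! ### Full column rank -/

section LeftInverse

theorem exists_left_inverse_of_rank_eq {n : ℕ} {κ : Type*} [Fintype κ] [DecidableEq κ]
    (F : Matrix κ (Fin n) ℝ) (hF : F.rank = n) : ∃ L : Matrix (Fin n) κ ℝ, L * F = 1 := by
  rw [← Matrix.vecMul_surjective_iff_exists_left_inverse]
  have hr : Module.finrank ℝ (LinearMap.range F.transpose.mulVecLin) = n := by
    have := F.rank_transpose
    rw [hF] at this
    exact this
  have htop : LinearMap.range F.transpose.mulVecLin = ⊤ := by
    refine Submodule.eq_top_of_finrank_eq ?_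
    rw [hr]
    simp
  intro v
  obtain ⟨u, hu⟩ := LinearMap.range_eq_top.1 htop v
  exact ⟨u, by rw [← hu, Matrix.mulVecLin_apply, Matrix.mulVec_transpose]⟩

end LeftInverse

/-! ### Weighted residuals with degenerating weights -/

section WeightedNorm

open Finset

variable {ι : Type*} [Fintype ι] {s : ℕ → ι → ℝ} {sl : ι → ℝ} {d : ℕ → ι → ℝ}

/-- Where the limit of `s` is zero the term is eventually omitted; elsewhere the weight converges.
-/
theorem tendsto_wnormSq_zero (hs : ∀ q, Tendsto (fun T => s T q) atTop (𝓝 (sl q)))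
    (hs0 : ∀ q, sl q = 0 → ∀ᶠ T in atTop, s T q = 0)
    (hd : ∀ q, Tendsto (fun T => d T q) atTop (𝓝 0)) :
    Tendsto (fun T => wnormSq (fun q => 1 / s T q) (d T)) atTop (𝓝 0) := by
  rw [← Finset.sum_const_zero (ι := ι) (s := univ)]
  refine tendsto_finsetSum _ fun q _ => ?_
  by_cases hq : sl q = 0
  · refine tendsto_const_nhds.congr' ?_
    filter_upwards [hs0 q hq] with T hT
    simp [hT]
  · have := ((tendsto_const_nhds (x := (1 : ℝ))).div (hs q) hq).mul ((hd q).pow 2)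
    simpa using this

/-- Once the weights are nonnegative, a single term gives `d ^ 2 ≤ s * wnormSq`, and `s` stays
bounded. Nothing can be said about cells with limit zero. -/
theorem tendsto_zero_of_wnormSq (hs : ∀ q, Tendsto (fun T => s T q) atTop (𝓝 (sl q)))
    (hsl : ∀ q, 0 ≤ sl q) (hs0 : ∀ q, sl q = 0 → ∀ᶠ T in atTop, s T q = 0)
    (hd : Tendsto (fun T => wnormSq (fun q => 1 / s T q) (d T)) atTop (𝓝 0))
    {q : ι} (hq : sl q ≠ 0) : Tendsto (fun T => d T q) atTop (𝓝 0) := by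
  have hnn : ∀ᶠ T in atTop, ∀ q, 0 ≤ s T q := by
    refine eventually_all.2 fun q => ?_
    rcases (hsl q).eq_or_lt with h | h
    · exact (hs0 q h.symm).mono fun T hT => hT.ge
    · exact ((hs q).eventually (lt_mem_nhds h)).mono fun T hT => hT.le
  have hpos := (hs q).eventually (lt_mem_nhds ((hsl q).lt_of_ne' hq))
  have hprod := (hs q).mul hd
  rw [mul_zero] at hprod
  have hsq : Tendsto (fun T => d T q ^ 2) atTop (𝓝 0) := by
    refine squeeze_zero' (Eventually.of_forall fun T => sq_nonneg _) ?_ hprod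
    filter_upwards [hnn, hpos] with T h1 h2
    have hle : 1 / s T q * d T q ^ 2 ≤ wnormSq (fun q => 1 / s T q) (d T) :=
      single_le_sum (f := fun q => 1 / s T q * d T q ^ 2)
        (fun q _ => mul_nonneg (one_div_nonneg.2 (h1 q)) (sq_nonneg _)) (mem_univ q)
    calc d T q ^ 2 = s T q * (1 / s T q * d T q ^ 2) := by field_simp
      _ ≤ _ := mul_le_mul_of_nonneg_left hle h2.le
  have := hsq.sqrt
  simp only [Real.sqrt_sq_eq_abs, Real.sqrt_zero] at this
  exact (tendsto_zero_iff_abs_tendsto_zero _).2 this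

theorem wnormSq_nonneg {w x : ι → ℝ} (hw : ∀ q, 0 ≤ w q) : 0 ≤ wnormSq w x :=
  sum_nonneg fun q _ => mul_nonneg (hw q) (sq_nonneg _)

theorem eventually_wnormSq_nonneg (hs : ∀ q, Tendsto (fun T => s T q) atTop (𝓝 (sl q)))
    (hsl : ∀ q, 0 ≤ sl q) (hs0 : ∀ q, sl q = 0 → ∀ᶠ T in atTop, s T q = 0) :
    ∀ᶠ T in atTop, 0 ≤ wnormSq (fun q => 1 / s T q) (d T) := by
  have hnn : ∀ᶠ T in atTop, ∀ q, 0 ≤ s T q := by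
    refine eventually_all.2 fun q => ?_
    rcases (hsl q).eq_or_lt with h | h
    · exact (hs0 q h.symm).mono fun T hT => hT.ge
    · exact ((hs q).eventually (lt_mem_nhds h)).mono fun T hT => hT.le
  exact hnn.mono fun T hT => wnormSq_nonneg fun q => one_div_nonneg.2 (hT q)

end WeightedNorm

/-! ### Consistency of the estimated stationary distribution -/

section Mixture

open Finset

variable {n : ℕ} {π : Fin n → ℝ}

theorem tendsto_mulVec_of_left_inverse {κ : Type*} [Fintype κ] {K : Matrix κ (Fin n) ℝ}
    {L : Matrix (Fin n) κ ℝ} (hL : L * K = 1) {x : ℕ → Fin n → ℝ} {v : Fin n → ℝ}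
    (h : ∀ k, Tendsto (fun T => K.mulVec (x T) k) atTop (𝓝 (K.mulVec v k))) :
    Tendsto x atTop (𝓝 v) := by
  rw [tendsto_pi_nhds]
  intro i
  have key : ∀ u, u i = ∑ k, L i k * K.mulVec u k := fun u => by
    conv_lhs => rw [← Matrix.one_mulVec u, ← hL, ← Matrix.mulVec_mulVec]
    rfl
  rw [key v]
  simp only [key (x _)]
  exact tendsto_finsetSum _ fun k _ => (h k).const_mul _

/-- The value at the feasible point `π` tends to zero and dominates the minimum. All limit weights
are positive, so every residual vanishes, and `L` inverts `K`. -/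
theorem tendsto_of_isMixtureEstimate {K L : Matrix (Fin n) (Fin n) ℝ} (hL : L * K = 1)
    (hπ : π ∈ stdSimplex ℝ (Fin n)) (hpos : ∀ k, 0 < K.mulVec π k) {r x : ℕ → Fin n → ℝ}
    (hr : ∀ k, Tendsto (fun T => r T k) atTop (𝓝 (K.mulVec π k)))
    (hx : ∀ T, IsMixtureEstimate K (r T) (x T)) : Tendsto x atTop (𝓝 π) := by
  have hr0 : ∀ k, K.mulVec π k = 0 → ∀ᶠ T in atTop, r T k = 0 := fun k hk =>
    absurd hk (hpos k).ne'
  have hπ0 : Tendsto (fun T => wnormSq (fun k => 1 / r T k) fun k => r T k - K.mulVec π k)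
      atTop (𝓝 0) :=
    tendsto_wnormSq_zero hr hr0 fun k => by simpa using (hr k).sub_const (K.mulVec π k)
  have hx0 : Tendsto (fun T => wnormSq (fun k => 1 / r T k) fun k => r T k - K.mulVec (x T) k)
      atTop (𝓝 0) :=
    tendsto_of_tendsto_of_tendsto_of_le_of_le' tendsto_const_nhds hπ0
      (eventually_wnormSq_nonneg hr (fun k => (hpos k).le) hr0)
      (Eventually.of_forall fun T => (hx T).2 hπ)
  refine tendsto_mulVec_of_left_inverse hL fun k => ?_
  have := (hr k).sub (tendsto_zero_of_wnormSq hr (fun k => (hpos k).le) hr0 hx0 (hpos k).ne')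
  simpa using this

/-- Zero weights are harmless: they belong to rows of `B` that vanish. -/
theorem tendsto_piHat {m : ℕ} {B : Matrix (Fin m) (Fin n) ℝ} {L : Matrix (Fin n) (Fin m) ℝ}
    (hB : IsColStochastic B) (hL : L * B = 1) (hπ : π ∈ stdSimplex ℝ (Fin n))
    (hpos : ∀ i, 0 < π i) {r : ℕ → Fin m → ℝ}
    (hr : ∀ k, Tendsto (fun T => r T k) atTop (𝓝 (B.mulVec π k))) :
    Tendsto (fun T => piHat B (r T)) atTop (𝓝 π) := by
  have hρ : ∀ k, 0 ≤ B.mulVec π k := fun k => by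
    rw [Matrix.mulVec, dotProduct]
    exact sum_nonneg fun j _ => mul_nonneg (hB.1 k j) (hπ.1 j)
  have hrow : ∀ k, B.mulVec π k = 0 → ∀ j, B k j = 0 := fun k hk j => by
    rw [Matrix.mulVec, dotProduct,
      sum_eq_zero_iff_of_nonneg fun j _ => mul_nonneg (hB.1 k j) (hπ.1 j)] at hk
    simpa [(hpos j).ne'] using hk j (mem_univ j)
  let W : (Fin m → ℝ) → Matrix (Fin n) (Fin n) ℝ := fun r =>
    B.transpose * Matrix.diagonal (fun k => 1 / r k) * B
  have hW : ∀ r i j, W r i j = ∑ k, B k i * (1 / r k) * B k j := fun r i j => by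
    simp only [W]
    rw [Matrix.mul_apply]
    simp only [Matrix.mul_diagonal, Matrix.transpose_apply]
  have hWlim : Tendsto (fun T => W (r T)) atTop (𝓝 (W (B.mulVec π))) := by
    refine tendsto_pi_nhds.2 fun i => tendsto_pi_nhds.2 fun j => ?_
    simp only [hW]
    refine tendsto_finsetSum _ fun k _ => ?_
    by_cases hk : B.mulVec π k = 0
    · simp [hrow k hk]
    · exact ((tendsto_const_nhds.div (hr k) hk).const_mul _).mul_const _
  have hWv : ∀ v, (W (B.mulVec π)).mulVec v =
      B.transpose.mulVec fun k => 1 / B.mulVec π k * B.mulVec v k := fun v => by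
    simp only [W, ← Matrix.mulVec_mulVec]
    congr 1
    ext k
    rw [Matrix.mulVec_diagonal]
  -- At the limiting weights `W π = Bᵀ 1`, and the columns of `B` sum to one; rows omitted by `1 / 0
  -- = 0` are zero anyway.
  have hWπ : (W (B.mulVec π)).mulVec π = fun _ => 1 := by
    rw [hWv]
    ext j
    refine Eq.trans ?_ (hB.2 j)
    simp only [Matrix.mulVec, dotProduct, Matrix.transpose_apply]
    refine sum_congr rfl fun k _ => ?_
    by_cases hk : B.mulVec π k = 0
    · simp [hrow k hk]
    · have hk' : ∑ i, B k i * π i ≠ 0 := hk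
      field_simp
  -- The quadratic form of `W` is the weighted square of `B v`, so a kernel vector satisfies `B v =
  -- 0`. Invertibility at the limit is enough, whatever the inverse means along the sequence.
  have hdet : (W (B.mulVec π)).det ≠ 0 := by
    intro h0
    obtain ⟨v, hv, hv0⟩ := Matrix.exists_mulVec_eq_zero_iff.2 h0
    refine hv ?_
    have hq : ∑ k, 1 / B.mulVec π k * B.mulVec v k ^ 2 = 0 := by
      have : v ⬝ᵥ (W (B.mulVec π)).mulVec v = 0 := by rw [hv0, dotProduct_zero]
      rw [hWv, Matrix.dotProduct_mulVec, Matrix.vecMul_transpose] at this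
      rw [← this, dotProduct]
      exact sum_congr rfl fun k _ => by ring
    have hBv : ∀ k, B.mulVec v k = 0 := fun k => by
      rw [sum_eq_zero_iff_of_nonneg fun k _ =>
        mul_nonneg (one_div_nonneg.2 (hρ k)) (sq_nonneg _)] at hq
      by_cases hk : B.mulVec π k = 0
      · rw [Matrix.mulVec, dotProduct]
        exact sum_eq_zero fun j _ => by rw [hrow k hk j, zero_mul]
      · simpa [hk] using hq k (mem_univ k)
    have : v = L.mulVec (B.mulVec v) := by rw [Matrix.mulVec_mulVec, hL, Matrix.one_mulVec]
    rw [this, funext hBv]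
    exact L.mulVec_zero
  have hinv : Tendsto (fun T => (W (r T))⁻¹) atTop (𝓝 (W (B.mulVec π))⁻¹) := by
    refine (continuousAt_matrix_inv _ ?_).tendsto.comp hWlim
    rw [Ring.inverse_eq_inv']
    exact continuousAt_inv₀ hdet
  have hxlim : ∀ i, Tendsto (fun T => (W (r T))⁻¹.mulVec (fun _ => 1) i) atTop (𝓝 (π i)) := by
    have e : (W (B.mulVec π))⁻¹.mulVec (fun _ => 1) = π := by
      rw [← hWπ, Matrix.mulVec_mulVec, Matrix.nonsing_inv_mul _ (isUnit_iff_ne_zero.2 hdet),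
        Matrix.one_mulVec]
    intro i
    conv => enter [3, 1]; rw [← e]
    simp only [Matrix.mulVec, dotProduct]
    exact tendsto_finsetSum _ fun j _ =>
      (tendsto_pi_nhds.1 (tendsto_pi_nhds.1 hinv i) j).mul_const _
  rw [tendsto_pi_nhds]
  intro i
  have hnorm : ∑ j, |π j| = 1 := by
    rw [← hπ.2]
    exact sum_congr rfl fun j _ => abs_of_nonneg (hπ.1 j)
  have := (hxlim i).div (tendsto_finsetSum univ fun j _ => (hxlim j).abs) (by rw [hnorm]; norm_num)
  rw [hnorm, div_one] at this
  exact this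

end Mixture

/-! ### Consistency of the estimated transition matrix -/

section Transition

open Finset

variable {n : ℕ} {π : Fin n → ℝ} {A : Matrix (Fin n) (Fin n) ℝ}

/-- The constraint sets `{M | M p = p}` are lower hemicontinuous at a positive `p = π`. -/
theorem exists_feasible_tendsto (hA : IsColStochastic A) (hπ : IsStationary A π) {a₀ : ℝ}
    (ha₀ : 0 < a₀) (hlow : ∀ k, a₀ ≤ π k) {p : ℕ → Fin n → ℝ} (hp : Tendsto p atTop (𝓝 π)) :
    ∃ N : ℕ → Matrix (Fin n) (Fin n) ℝ, (∀ᶠ T in atTop, N T ∈ feasibleTransitions (p T)) ∧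
      Tendsto N atTop (𝓝 A) := by
  have hp' := tendsto_pi_nhds.1 hp
  have hpos : ∀ k, 0 < π k := fun k => ha₀.trans_le (hlow k)
  -- Chosen so that `c T * π j ≤ p T j`: since `π j ≥ a₀`, the loss `‖p T - π‖ / a₀ * π j` is at
  -- least `‖p T - π‖`.
  let c : ℕ → ℝ := fun T => 1 - ‖p T - π‖ / a₀
  have hc : Tendsto c atTop (𝓝 1) := by
    have := ((tendsto_iff_norm_sub_tendsto_zero.1 hp).div_const a₀).const_sub 1
    simpa using this
  -- As a joint law with marginal `p T`, this is `c T` times the stationary law `A i j * π j`, plus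
  -- the leftover mass `p T j - c T * π j` on the diagonal. Both marginals are then `p T`.
  refine ⟨fun T => Matrix.of fun i j => c T * (A i j * π j / p T j) +
    (1 : Matrix (Fin n) (Fin n) ℝ) i j * (1 - c T * (π j / p T j)), ?_, ?_⟩
  · have hc0 : ∀ᶠ T in atTop, 0 < c T := hc.eventually (lt_mem_nhds one_pos)
    have hp0 : ∀ᶠ T in atTop, ∀ j, 0 < p T j :=
      eventually_all.2 fun j => (hp' j).eventually (lt_mem_nhds (hpos j))
    filter_upwards [hc0, hp0] with T hcT hpT
    have hcp : ∀ j, c T * π j ≤ p T j := fun j => by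
      have h1 : π j - p T j ≤ ‖p T - π‖ := by
        have := norm_le_pi_norm (p T - π) j
        rw [Pi.sub_apply, Real.norm_eq_abs] at this
        linarith [neg_abs_le (p T j - π j)]
      have h2 : ‖p T - π‖ ≤ ‖p T - π‖ / a₀ * π j := by
        calc ‖p T - π‖ = ‖p T - π‖ / a₀ * a₀ := by field_simp
          _ ≤ _ := mul_le_mul_of_nonneg_left (hlow j) (by positivity)
      have : c T * π j = π j - ‖p T - π‖ / a₀ * π j := by simp only [c]; ring
      linarith
    have hfrac : ∀ j, c T * (π j / p T j) ≤ 1 := fun j => by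
      rw [← mul_div_assoc, div_le_one (hpT j)]
      exact hcp j
    refine ⟨fun i j => ?_, fun j => ?_, ?_⟩
    · rw [Matrix.of_apply]
      refine add_nonneg ?_ (mul_nonneg ?_ (by linarith [hfrac j]))
      · exact mul_nonneg hcT.le (div_nonneg (mul_nonneg (hA.1 i j) (hpos j).le) (hpT j).le)
      · rw [Matrix.one_apply]
        split_ifs <;> norm_num
    · simp only [Matrix.of_apply]
      rw [sum_add_distrib, ← mul_sum, ← sum_div, ← sum_mul, ← sum_mul, hA.2 j]
      simp [Matrix.one_apply]
    · ext i
      have hstat : ∑ j, A i j * π j = π i := congrFun hπ.2 i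
      simp only [Matrix.mulVec, dotProduct, Matrix.of_apply]
      calc ∑ j, (c T * (A i j * π j / p T j) + (1 : Matrix (Fin n) (Fin n) ℝ) i j *
            (1 - c T * (π j / p T j))) * p T j
          = ∑ j, (c T * (A i j * π j) + (1 : Matrix (Fin n) (Fin n) ℝ) i j *
              (p T j - c T * π j)) := by
            refine sum_congr rfl fun j _ => ?_
            have := (hpT j).ne'
            field_simp
        _ = c T * π i + (p T i - c T * π i) := by
            rw [sum_add_distrib, ← mul_sum, hstat]
            simp [Matrix.one_apply]
        _ = p T i := by ring
  · refine tendsto_pi_nhds.2 fun i => tendsto_pi_nhds.2 fun j => ?_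
    simp only [Matrix.of_apply]
    have hj := (hpos j).ne'
    have h1 := hc.mul (((tendsto_const_nhds (x := A i j * π j))).div (hp' j) hj)
    have h2 := (((hc.mul ((tendsto_const_nhds (x := π j)).div (hp' j) hj))).const_sub 1).const_mul
      ((1 : Matrix (Fin n) (Fin n) ℝ) i j)
    have := h1.add h2
    simpa [hj] using this

variable {κ : Type*}

theorem tendsto_pairMap {p : ℕ → Fin n → ℝ} {pl : Fin n → ℝ} (hp : Tendsto p atTop (𝓝 pl))
    {F : ℕ → Matrix κ (Fin n) ℝ} {Fl : Matrix κ (Fin n) ℝ} (hF : Tendsto F atTop (𝓝 Fl))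
    {M : ℕ → Matrix (Fin n) (Fin n) ℝ} {Ml : Matrix (Fin n) (Fin n) ℝ}
    (hM : Tendsto M atTop (𝓝 Ml)) (q : κ × κ) :
    Tendsto (fun T => pairMap (p T) (F T) (M T) q) atTop (𝓝 (pairMap pl Fl Ml q)) := by
  have hF' := fun k j => tendsto_pi_nhds.1 (tendsto_pi_nhds.1 hF k) j
  have hM' := fun i j => tendsto_pi_nhds.1 (tendsto_pi_nhds.1 hM i) j
  exact tendsto_finsetSum _ fun i _ => tendsto_finsetSum _ fun j _ =>
    (((tendsto_pi_nhds.1 hp j).mul (hF' _ j)).mul (hF' _ i)).mul (hM' i j)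

/-- Uniformity of the preceding convergence over stochastic matrices. -/
theorem tendsto_pairMap_sub {p : ℕ → Fin n → ℝ} {pl : Fin n → ℝ} (hp : Tendsto p atTop (𝓝 pl))
    {F : ℕ → Matrix κ (Fin n) ℝ} {Fl : Matrix κ (Fin n) ℝ} (hF : Tendsto F atTop (𝓝 Fl))
    {M : ℕ → Matrix (Fin n) (Fin n) ℝ} (hM : ∀ T i j, |M T i j| ≤ 1) (q : κ × κ) :
    Tendsto (fun T => pairMap (p T) (F T) (M T) q - pairMap pl Fl (M T) q) atTop (𝓝 0) := by
  have hF' := fun k j => tendsto_pi_nhds.1 (tendsto_pi_nhds.1 hF k) j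
  simp only [pairMap, ← sum_sub_distrib]
  rw [← sum_const_zero (ι := Fin n) (s := univ)]
  refine tendsto_finsetSum _ fun i _ => ?_
  rw [← sum_const_zero (ι := Fin n) (s := univ)]
  refine tendsto_finsetSum _ fun j _ => ?_
  simp only [← sub_mul]
  have hz : Tendsto (fun T => p T j * F T q.1 j * F T q.2 i - pl j * Fl q.1 j * Fl q.2 i) atTop
      (𝓝 0) := by
    have := (((tendsto_pi_nhds.1 hp j).mul (hF' q.1 j)).mul (hF' q.2 i)).sub_const
      (pl j * Fl q.1 j * Fl q.2 i)
    simpa using this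
  refine squeeze_zero_norm (fun T => ?_) (by simpa using hz.abs)
  rw [Real.norm_eq_abs, abs_mul]
  exact mul_le_of_le_one_right (abs_nonneg _) (hM T i j)

variable [Fintype κ]

/-- The contraction factors over the two outputs. Constant `g`, `h` give the total mass; rows of a
left inverse of `F` isolate one entry of `M`. -/
theorem sum_sum_mul_pairMap (g h : κ → ℝ) (p : Fin n → ℝ) (F : Matrix κ (Fin n) ℝ)
    (M : Matrix (Fin n) (Fin n) ℝ) :
    ∑ k, ∑ k', g k * h k' * pairMap p F M (k, k') =
      ∑ i, ∑ j, p j * (∑ k, g k * F k j) * (∑ k', h k' * F k' i) * M i j := by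
  have e : ∀ i j, p j * (∑ k, g k * F k j) * (∑ k', h k' * F k' i) * M i j =
      ∑ k, ∑ k', g k * h k' * (p j * F k j * F k' i * M i j) := fun i j => by
    rw [mul_assoc (p j), sum_mul_sum, mul_sum, sum_mul]
    refine sum_congr rfl fun k _ => ?_
    rw [mul_sum, sum_mul]
    exact sum_congr rfl fun k' _ => by ring
  simp only [e]
  simp only [pairMap, mul_sum]
  calc _ = ∑ k, ∑ i, ∑ k', ∑ j, g k * h k' * (p j * F k j * F k' i * M i j) :=
        sum_congr rfl fun k _ => sum_comm
    _ = ∑ i, ∑ k, ∑ k', ∑ j, g k * h k' * (p j * F k j * F k' i * M i j) := sum_comm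
    _ = ∑ i, ∑ k, ∑ j, ∑ k', g k * h k' * (p j * F k j * F k' i * M i j) :=
        sum_congr rfl fun i _ => sum_congr rfl fun k _ => sum_comm
    _ = _ := sum_congr rfl fun i _ => sum_comm

theorem sum_pairMap {p : Fin n → ℝ} {F : Matrix κ (Fin n) ℝ} {M : Matrix (Fin n) (Fin n) ℝ}
    (hF : ∀ j, ∑ k, F k j = 1) (hM : ∀ j, ∑ i, M i j = 1) :
    ∑ q, pairMap p F M q = ∑ j, p j := by
  rw [Fintype.sum_prod_type]
  have := sum_sum_mul_pairMap (fun _ => 1) (fun _ => 1) p F M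
  simp only [one_mul, hF, mul_one] at this
  rw [this, sum_comm]
  simp [← mul_sum, hM]

theorem sum_left_inverse_pairMap {F : Matrix κ (Fin n) ℝ} {L : Matrix (Fin n) κ ℝ}
    (hL : L * F = 1) (p : Fin n → ℝ) (M : Matrix (Fin n) (Fin n) ℝ) (i j : Fin n) :
    ∑ k, ∑ k', L j k * L i k' * pairMap p F M (k, k') = p j * M i j := by
  have e : ∀ a b, ∑ k, L a k * F k b = (1 : Matrix (Fin n) (Fin n) ℝ) a b := fun a b => by
    rw [← hL, Matrix.mul_apply]
  rw [sum_sum_mul_pairMap]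
  simp [e, Matrix.one_apply]

/-- Consistency of the second program. -/
theorem tendsto_of_isTransitionEstimate (hA : IsColStochastic A) (hπ : IsStationary A π) {a₀ : ℝ}
    (ha₀ : 0 < a₀) (hlow : ∀ k, a₀ ≤ π k) {F : Matrix κ (Fin n) ℝ} (hF : IsColStochastic F)
    {L : Matrix (Fin n) κ ℝ} (hL : L * F = 1) {p : ℕ → Fin n → ℝ} (hp : Tendsto p atTop (𝓝 π))
    {Fh : ℕ → Matrix κ (Fin n) ℝ} (hFh : Tendsto Fh atTop (𝓝 F)) {s : ℕ → κ → κ → ℝ}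
    (hs : ∀ k k', Tendsto (fun T => s T k k') atTop (𝓝 (pairMap π F A (k, k'))))
    (hs0 : ∀ k k', pairMap π F A (k, k') = 0 → ∀ᶠ T in atTop, s T k k' = 0)
    {M : ℕ → Matrix (Fin n) (Fin n) ℝ} (hM : ∀ T, IsTransitionEstimate (p T) (Fh T) (s T) (M T)) :
    Tendsto M atTop (𝓝 A) := by
  have hpos : ∀ k, 0 < π k := fun k => ha₀.trans_le (hlow k)
  have hpair0 : ∀ N : Matrix (Fin n) (Fin n) ℝ, (∀ i j, 0 ≤ N i j) → ∀ q, 0 ≤ pairMap π F N q :=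
    fun N hN q => sum_nonneg fun i _ => sum_nonneg fun j _ =>
      mul_nonneg (mul_nonneg (mul_nonneg (hpos j).le (hF.1 _ _)) (hF.1 _ _)) (hN i j)
  have hM1 : ∀ T i j, |M T i j| ≤ 1 := fun T i j => by
    rw [abs_of_nonneg ((hM T).1.1 i j), ← (hM T).1.2.1 j]
    exact single_le_sum (f := fun i => M T i j) (fun i _ => (hM T).1.1 i j) (mem_univ i)
  have hs' : ∀ q : κ × κ, Tendsto (fun T => s T q.1 q.2) atTop (𝓝 (pairMap π F A q)) :=
    fun q => hs q.1 q.2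
  have hs0' : ∀ q : κ × κ, pairMap π F A q = 0 → ∀ᶠ T in atTop, s T q.1 q.2 = 0 :=
    fun q => hs0 q.1 q.2
  have hnn := hpair0 A hA.1
  obtain ⟨N, hN, hNA⟩ := exists_feasible_tendsto hA hπ ha₀ hlow hp
  have hN0 : Tendsto (fun T => wnormSq (fun q : κ × κ => 1 / s T q.1 q.2)
      fun q => s T q.1 q.2 - pairMap (p T) (Fh T) (N T) q) atTop (𝓝 0) :=
    tendsto_wnormSq_zero hs' hs0' fun q => by
      simpa using (hs' q).sub (tendsto_pairMap hp hFh hNA q)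
  have hM0 : Tendsto (fun T => wnormSq (fun q : κ × κ => 1 / s T q.1 q.2)
      fun q => s T q.1 q.2 - pairMap (p T) (Fh T) (M T) q) atTop (𝓝 0) :=
    tendsto_of_tendsto_of_tendsto_of_le_of_le' tendsto_const_nhds hN0
      (eventually_wnormSq_nonneg hs' hnn hs0') (hN.mono fun T hT => (hM T).2 hT)
  -- The estimated `p T` and `Fh T` may be replaced by their limits, uniformly in the matrix,
  -- because the entries of `M T` are bounded by one.
  have hsupp : ∀ q, pairMap π F A q ≠ 0 →
      Tendsto (fun T => pairMap π F (M T) q) atTop (𝓝 (pairMap π F A q)) := fun q hq => by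
    have := ((hs' q).sub (tendsto_zero_of_wnormSq hs' hnn hs0' hM0 hq)).sub
      (tendsto_pairMap_sub hp hFh hM1 q)
    simpa using this
  -- The objective does not see these cells. Their mass is one minus the mass of the others, which
  -- converges to the full mass one of the limit.
  have hrest : Tendsto (fun T => ∑ q with pairMap π F A q = 0, pairMap π F (M T) q) atTop
      (𝓝 0) := by
    have hsplit : ∀ N : Matrix (Fin n) (Fin n) ℝ, (∀ j, ∑ i, N i j = 1) →
        ∑ q with pairMap π F A q = 0, pairMap π F N q =
          1 - ∑ q with pairMap π F A q ≠ 0, pairMap π F N q := fun N hN => by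
      rw [eq_sub_iff_add_eq, sum_filter_add_sum_filter_not, sum_pairMap hF.2 hN, hπ.1.2]
    have hlim : Tendsto (fun T => 1 - ∑ q with pairMap π F A q ≠ 0, pairMap π F (M T) q) atTop
        (𝓝 (1 - ∑ q with pairMap π F A q ≠ 0, pairMap π F A q)) :=
      (tendsto_finsetSum _ fun q hq => hsupp q (mem_filter.1 hq).2).const_sub 1
    rw [← hsplit A hA.2, sum_eq_zero fun q hq => (mem_filter.1 hq).2] at hlim
    exact hlim.congr fun T => (hsplit (M T) (hM T).1.2.1).symm
  have hall : ∀ q, Tendsto (fun T => pairMap π F (M T) q) atTop (𝓝 (pairMap π F A q)) := by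
    intro q
    by_cases hq : pairMap π F A q = 0
    · rw [hq]
      refine squeeze_zero (fun T => hpair0 _ (hM T).1.1 q) (fun T => ?_) hrest
      exact single_le_sum (f := fun q => pairMap π F (M T) q)
        (fun q _ => hpair0 _ (hM T).1.1 q) (mem_filter.2 ⟨mem_univ q, hq⟩)
    · exact hsupp q hq
  refine tendsto_pi_nhds.2 fun i => tendsto_pi_nhds.2 fun j => ?_
  have hrec : ∀ N : Matrix (Fin n) (Fin n) ℝ, N i j =
      (π j)⁻¹ * ∑ k, ∑ k', L j k * L i k' * pairMap π F N (k, k') := fun N => by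
    rw [sum_left_inverse_pairMap hL, inv_mul_cancel_left₀ (hpos j).ne']
  rw [hrec A]
  simp only [hrec (M _)]
  exact (tendsto_finsetSum _ fun k _ => tendsto_finsetSum _ fun k' _ =>
    (hall (k, k')).const_mul _).const_mul _

end Transition

/-! ### Empirical frequencies on a finite alphabet -/

section Discrete

open Finset

variable {n m : ℕ} {B : Matrix (Fin m) (Fin n) ℝ}

theorem isProbabilityMeasure_discreteEmission (hB : IsColStochastic B) (i : Fin n) :
    IsProbabilityMeasure (discreteEmission B i) := by
  refine ⟨?_⟩
  simp only [discreteEmission, Measure.coe_finsetSum, Finset.sum_apply, Measure.smul_apply,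
    measure_univ, smul_eq_mul, mul_one]
  rw [← ENNReal.ofReal_sum_of_nonneg fun k _ => hB.1 k i, hB.2, ENNReal.ofReal_one]

theorem integral_discreteEmission_indicator (hB : IsColStochastic B) (i : Fin n) (k : Fin m) :
    ∫ y, (if y = k then (1 : ℝ) else 0) ∂(discreteEmission B i) = B k i := by
  rw [discreteEmission, integral_finsetSum_measure fun l _ =>
    (integrable_dirac (by simp)).smul_measure ENNReal.ofReal_ne_top]
  simp [integral_smul_measure, hB.1]

variable {Ω : Type*} [MeasurableSpace Ω] {P : Measure Ω} [IsProbabilityMeasure P]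
  {A : Matrix (Fin n) (Fin n) ℝ} {p₀ π : Fin n → ℝ} {X : ℕ → Ω → Fin n} {Y : ℕ → Ω → Fin m}

theorem IsHMM.ae_tendsto_rhoHat (h : IsHMM P A p₀ (discreteEmission B) X Y)
    (hA : IsColStochastic A) (hp₀ : p₀ ∈ stdSimplex ℝ (Fin n)) (hgeo : IsGeometricallyErgodic A π)
    (hB : IsColStochastic B) :
    ∀ᵐ ω ∂P, ∀ k, Tendsto (fun T => rhoHat (fun t => Y t ω) T k) atTop (𝓝 (B.mulVec π k)) := by
  have := isProbabilityMeasure_discreteEmission hB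
  refine ae_all_iff.2 fun k => ?_
  have key := h.ae_tendsto_average_single hA hp₀ hgeo (a := fun y => if y = k then 1 else 0)
    (Measurable.of_discrete) (fun y => by split_ifs <;> norm_num)
    (fun i => Integrable.of_finite)
  simp only [integral_discreteEmission_indicator hB] at key
  exact key

theorem IsHMM.ae_tendsto_sigmaHat (h : IsHMM P A p₀ (discreteEmission B) X Y)
    (hA : IsColStochastic A) (hp₀ : p₀ ∈ stdSimplex ℝ (Fin n)) (hgeo : IsGeometricallyErgodic A π)
    (hπ : ∀ i, 0 < π i) (hB : IsColStochastic B) :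
    ∀ᵐ ω ∂P, ∀ k k',
      Tendsto (fun T => sigmaHat (fun t => Y t ω) T k k') atTop (𝓝 (pairMap π B A (k, k'))) ∧
      (pairMap π B A (k, k') = 0 → ∀ T, sigmaHat (fun t => Y t ω) T k k' = 0) := by
  have := isProbabilityMeasure_discreteEmission hB
  refine ae_all_iff.2 fun k => ae_all_iff.2 fun k' => ?_
  have h0 : ∀ (l y : Fin m), (0 : ℝ) ≤ if y = l then 1 else 0 := fun l y => by
    split_ifs <;> norm_num
  have h1 : ∀ (l y : Fin m), (if y = l then (1 : ℝ) else 0) ≤ 1 := fun l y => by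
    split_ifs <;> norm_num
  have hlim : pairMean A (discreteEmission B) (fun y => if y = k then 1 else 0)
      (fun y => if y = k' then 1 else 0) π = pairMap π B A (k, k') := by
    simp only [pairMean, pairMap, integral_discreteEmission_indicator hB]
  have key := h.ae_tendsto_average_pair hA hp₀ hgeo (a := fun y => if y = k then 1 else 0)
    (b := fun y => if y = k' then 1 else 0) Measurable.of_discrete Measurable.of_discrete (h0 k)
    (fun i => Integrable.of_finite) (h0 k') (h1 k')
  rw [hlim] at key
  refine key.and ?_
  by_cases hz : pairMap π B A (k, k') = 0
  · have hzero := h.ae_eq_zero_of_pairMean_eq_zero hA hp₀ hπ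
      (a := fun y => if y = k then 1 else 0) (b := fun y => if y = k' then 1 else 0)
      Measurable.of_discrete Measurable.of_discrete (h0 k) (h1 k) (h0 k') (h1 k')
      (by rw [hlim, hz])
    filter_upwards [hzero] with ω hω _ T
    rw [sigmaHat, sum_eq_zero, mul_zero]
    intro t ht
    have := hω (t - 1)
    rwa [Nat.sub_add_cancel (mem_Ico.1 ht).1] at this
  · exact ae_of_all _ fun ω h' => absurd h' hz

end Discrete

/-! ### Posteriors and averages for outputs with densities -/

section Density

open Finset

variable {n : ℕ} {𝒴 : Type*} {f : Fin n → 𝒴 → ℝ} {π p : Fin n → ℝ}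

theorem posterior_nonneg (hf : ∀ i y, 0 ≤ f i y) (hp : ∀ i, 0 ≤ p i) (k : Fin n) (y : 𝒴) :
    0 ≤ posterior f p k y :=
  div_nonneg (mul_nonneg (hf k y) (hp k)) (sum_nonneg fun l _ => mul_nonneg (hf l y) (hp l))

theorem posterior_le_one (hf : ∀ i y, 0 ≤ f i y) (hp : ∀ i, 0 ≤ p i) (k : Fin n) (y : 𝒴) :
    posterior f p k y ≤ 1 :=
  div_le_one_of_le₀ (single_le_sum (f := fun l => f l y * p l)
    (fun l _ => mul_nonneg (hf l y) (hp l)) (mem_univ k))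
    (sum_nonneg fun l _ => mul_nonneg (hf l y) (hp l))

theorem eq_zero_of_posterior_eq_zero (hf : ∀ i y, 0 ≤ f i y) (hπ : ∀ i, 0 < π i) {k : Fin n}
    {y : 𝒴} (h : posterior f π k y = 0) : f k y = 0 := by
  rw [posterior, div_eq_zero_iff] at h
  have hk : f k y * π k = 0 := h.elim id fun hS =>
    (sum_eq_zero_iff_of_nonneg fun l _ => mul_nonneg (hf l y) (hπ l).le).1 hS k (mem_univ k)
  exact (mul_eq_zero.1 hk).resolve_right (hπ k).ne'

/-- The posteriors depend on the state probabilities uniformly in the output. -/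
theorem abs_posterior_sub_le (hf : ∀ i y, 0 ≤ f i y) (hπ : ∀ i, 0 < π i) {δ : ℝ} (hδ : δ ≤ 1 / 2)
    (hp : ∀ l, |p l - π l| ≤ δ * π l) (k : Fin n) (y : 𝒴) :
    |posterior f p k y - posterior f π k y| ≤ 4 * δ := by
  have hδ0 : 0 ≤ δ := nonneg_of_mul_nonneg_left ((abs_nonneg _).trans (hp k)) (hπ k)
  set S := ∑ l, f l y * π l with hS
  set S' := ∑ l, f l y * p l with hS'
  have hS0 : 0 ≤ S := sum_nonneg fun l _ => mul_nonneg (hf l y) (hπ l).le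
  have hSS : |S' - S| ≤ δ * S := by
    rw [hS, hS', ← sum_sub_distrib, mul_sum]
    refine (abs_sum_le_sum_abs _ _).trans (sum_le_sum fun l _ => ?_)
    rw [← mul_sub, abs_mul, abs_of_nonneg (hf l y)]
    calc f l y * |p l - π l| ≤ f l y * (δ * π l) := mul_le_mul_of_nonneg_left (hp l) (hf l y)
      _ = δ * (f l y * π l) := by ring
  have hkS : f k y * π k ≤ S := single_le_sum (f := fun l => f l y * π l)
    (fun l _ => mul_nonneg (hf l y) (hπ l).le) (mem_univ k)
  have hk0 : 0 ≤ f k y * π k := mul_nonneg (hf k y) (hπ k).le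
  simp only [posterior]
  rw [← hS, ← hS']
  rcases hS0.eq_or_lt with h0 | h0
  -- Where the mixture density vanishes so does `f k y`, and both posteriors are zero by convention.
  · have hfk : f k y = 0 := by
      have : f k y * π k = 0 := le_antisymm (h0 ▸ hkS) hk0
      exact (mul_eq_zero.1 this).resolve_right (hπ k).ne'
    rw [hfk]
    simpa using hδ0
  · have hS'S : S / 2 ≤ S' := by
      have := (abs_le.1 hSS).1
      have : δ * S ≤ 1 / 2 * S := mul_le_mul_of_nonneg_right hδ h0.le
      linarith
    have hS'0 : 0 < S' := by linarith
    have hnum : |f k y * (p k - π k)| ≤ δ * S := by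
      rw [abs_mul, abs_of_nonneg (hf k y)]
      calc f k y * |p k - π k| ≤ f k y * (δ * π k) := mul_le_mul_of_nonneg_left (hp k) (hf k y)
        _ = δ * (f k y * π k) := by ring
        _ ≤ δ * S := mul_le_mul_of_nonneg_left hkS hδ0
    have hq : |f k y * π k / S| ≤ 1 := by
      rw [abs_of_nonneg (div_nonneg hk0 h0.le)]
      exact div_le_one_of_le₀ hkS h0.le
    -- Both terms of the new numerator are at most `δ * S ≤ 2 * δ * S'`, whence the constant 4.
    have e : f k y * p k / S' - f k y * π k / S =
        (f k y * (p k - π k) - f k y * π k / S * (S' - S)) / S' := by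
      field_simp
      ring
    rw [e, abs_div, abs_of_pos hS'0, div_le_iff₀ hS'0]
    have h3 : |f k y * π k / S * (S' - S)| ≤ δ * S := by
      rw [abs_mul]
      exact (mul_le_of_le_one_left (abs_nonneg _) hq).trans hSS
    have h4 := abs_sub (f k y * (p k - π k)) (f k y * π k / S * (S' - S))
    have h5 : δ * S ≤ δ * (2 * S') := mul_le_mul_of_nonneg_left (by linarith) hδ0
    linarith

/-- Uniform convergence of the posteriors as the state probabilities converge. -/
theorem eventually_abs_posterior_sub_le (hf : ∀ i y, 0 ≤ f i y) (hπ : ∀ i, 0 < π i)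
    {p : ℕ → Fin n → ℝ} (hp : Tendsto p atTop (𝓝 π)) {ε : ℝ} (hε : 0 < ε) :
    ∀ᶠ T in atTop, ∀ k y, |posterior f (p T) k y - posterior f π k y| ≤ ε := by
  have hδ : 0 < min (1 / 2) (ε / 4) := by positivity
  have : ∀ᶠ T in atTop, ∀ l, |p T l - π l| ≤ min (1 / 2) (ε / 4) * π l := by
    refine eventually_all.2 fun l => ?_
    have hl := (tendsto_pi_nhds.1 hp l).sub_const (π l)
    rw [sub_self] at hl
    have := hl.abs
    rw [abs_zero] at this
    exact (this.eventually (gt_mem_nhds (mul_pos hδ (hπ l)))).mono fun T hT => hT.le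
  filter_upwards [this] with T hT k y
  refine (abs_posterior_sub_le hf hπ (min_le_left _ _) hT k y).trans ?_
  linarith [min_le_right (1 / 2 : ℝ) (ε / 4)]

/-- The estimate `p T` may depend on the whole sample, so the strong law does not apply to `etaHat f
(p T)` directly. The comparison with the fixed posteriors is uniform in the outputs. -/
theorem tendsto_etaHat_sub (hf : ∀ i y, 0 ≤ f i y) (hπ : ∀ i, 0 < π i)
    {p : ℕ → Fin n → ℝ} (hp0 : ∀ T i, 0 ≤ p T i) (hp : Tendsto p atTop (𝓝 π)) (y : ℕ → 𝒴)
    (k k' : Fin n) :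
    Tendsto (fun T => etaHat f (p T) y T k k' - etaHat f π y T k k') atTop (𝓝 0) := by
  rw [Metric.tendsto_nhds]
  intro ε hε
  filter_upwards [eventually_abs_posterior_sub_le hf hπ hp (ε := ε / 4) (by positivity),
    eventually_ge_atTop 2] with T hT hT2
  have hT1 : (0 : ℝ) < (T : ℝ) - 1 := by
    have : (2 : ℝ) ≤ T := by exact_mod_cast hT2
    linarith
  rw [Real.dist_eq, sub_zero]
  simp only [etaHat]
  rw [← mul_sub, ← sum_sub_distrib, abs_mul, abs_of_pos (one_div_pos.2 hT1)]
  have hterm : ∀ a b, |posterior f (p T) k a * posterior f (p T) k' b -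
      posterior f π k a * posterior f π k' b| ≤ ε / 2 := fun a b => by
    have e : posterior f (p T) k a * posterior f (p T) k' b -
        posterior f π k a * posterior f π k' b =
        (posterior f (p T) k a - posterior f π k a) * posterior f (p T) k' b +
        posterior f π k a * (posterior f (p T) k' b - posterior f π k' b) := by ring
    have hπ' := fun i => (hπ i).le
    rw [e]
    refine (abs_add_le _ _).trans ?_
    rw [abs_mul, abs_mul, abs_of_nonneg (posterior_nonneg hf (hp0 T) k' b),
      abs_of_nonneg (posterior_nonneg hf hπ' k a)]
    have h1 := mul_le_of_le_one_right (abs_nonneg (posterior f (p T) k a - posterior f π k a))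
      (posterior_le_one hf (hp0 T) k' b)
    have h2 := mul_le_of_le_one_left (abs_nonneg (posterior f (p T) k' b - posterior f π k' b))
      (posterior_le_one hf hπ' k a)
    linarith [hT k a, hT k' b]
  have hsum := (abs_sum_le_sum_abs (fun t => posterior f (p T) k (y (t - 1)) *
    posterior f (p T) k' (y t) - posterior f π k (y (t - 1)) * posterior f π k' (y t))
    (Ico 1 T)).trans (sum_le_card_nsmul _ _ (ε / 2) fun t _ => hterm _ _)
  rw [Nat.card_Ico, nsmul_eq_mul, Nat.cast_sub (by omega), Nat.cast_one] at hsum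
  calc _ ≤ 1 / ((T : ℝ) - 1) * (((T : ℝ) - 1) * (ε / 2)) :=
        mul_le_mul_of_nonneg_left hsum (one_div_pos.2 hT1).le
    _ = ε / 2 := by field_simp
    _ < ε := half_lt_self hε

variable [MeasurableSpace 𝒴] {ν : Measure 𝒴}

theorem measurable_posterior (hf : ∀ i, Measurable (f i)) (p : Fin n → ℝ) (k : Fin n) :
    Measurable (posterior f p k) :=
  ((hf k).mul_const _).div (Finset.measurable_sum _ fun l _ => (hf l).mul_const _)

theorem IsDensity.integrable {g : 𝒴 → ℝ} (hg : IsDensity ν g) : Integrable g ν := by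
  refine ⟨hg.measurable.aestronglyMeasurable, ?_⟩
  rw [hasFiniteIntegral_iff_ofReal (ae_of_all _ hg.nonneg), hg.lintegral_eq_one]
  exact ENNReal.one_lt_top

theorem IsDensity.integral_eq_one {g : 𝒴 → ℝ} (hg : IsDensity ν g) : ∫ y, g y ∂ν = 1 := by
  rw [integral_eq_lintegral_of_nonneg_ae (ae_of_all _ hg.nonneg)
    hg.measurable.aestronglyMeasurable, hg.lintegral_eq_one, ENNReal.toReal_one]

theorem isProbabilityMeasure_densityEmission (hf : ∀ i, IsDensity ν (f i)) (i : Fin n) :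
    IsProbabilityMeasure (densityEmission ν f i) := by
  refine ⟨?_⟩
  rw [densityEmission, withDensity_apply _ MeasurableSet.univ, Measure.restrict_univ,
    (hf i).lintegral_eq_one]

theorem integral_densityEmission (hf : ∀ i, IsDensity ν (f i)) (i : Fin n) (g : 𝒴 → ℝ) :
    ∫ y, g y ∂(densityEmission ν f i) = ∫ y, g y * f i y ∂ν := by
  rw [densityEmission, integral_withDensity_eq_integral_toReal_smul
    (hf i).measurable.ennreal_ofReal (ae_of_all _ fun _ => ENNReal.ofReal_lt_top)]
  simp only [ENNReal.toReal_ofReal ((hf i).nonneg _), smul_eq_mul, mul_comm]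

theorem integrable_densityEmission_iff (hf : ∀ i, IsDensity ν (f i)) (i : Fin n) {g : 𝒴 → ℝ} :
    Integrable g (densityEmission ν f i) ↔ Integrable (fun y => g y * f i y) ν := by
  rw [densityEmission, integrable_withDensity_iff
    (hf i).measurable.ennreal_ofReal (ae_of_all _ fun _ => ENNReal.ofReal_lt_top)]
  simp only [ENNReal.toReal_ofReal ((hf i).nonneg _)]

theorem integrable_posterior_mul (hf : ∀ i, IsDensity ν (f i)) (hp : ∀ i, 0 ≤ p i)
    (k j : Fin n) : Integrable (fun y => posterior f p k y * f j y) ν := by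
  refine (hf j).integrable.mono' ((measurable_posterior (fun i => (hf i).measurable) p k).mul
    (hf j).measurable).aestronglyMeasurable (ae_of_all _ fun y => ?_)
  have h0 := posterior_nonneg (fun i => (hf i).nonneg) hp k y
  have h1 := posterior_le_one (fun i => (hf i).nonneg) hp k y
  rw [Real.norm_eq_abs, abs_of_nonneg (mul_nonneg h0 ((hf j).nonneg y))]
  exact mul_le_of_le_one_left ((hf j).nonneg y) h1

/-- Posteriors sum to one except where the mixture density vanishes; there every `f j` vanishes, as
`π` is positive. -/
theorem isColStochastic_fMatrix (hf : ∀ i, IsDensity ν (f i)) (hπ : ∀ i, 0 < π i) :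
    IsColStochastic (fMatrix ν f π) := by
  have hnn := fun i => (hf i).nonneg
  have hπ' := fun i => (hπ i).le
  refine ⟨fun k i => integral_nonneg fun y =>
    mul_nonneg (posterior_nonneg hnn hπ' k y) (hnn i y), fun j => ?_⟩
  simp only [fMatrix, Matrix.of_apply]
  rw [← integral_finsetSum _ fun k _ => integrable_posterior_mul hf hπ' k j,
    ← (hf j).integral_eq_one]
  congr 1
  ext y
  simp only [posterior]
  rw [← sum_mul, ← sum_div]
  by_cases hS : ∑ l, f l y * π l = 0
  · have : f j y * π j = 0 :=
      (sum_eq_zero_iff_of_nonneg fun l _ => mul_nonneg (hnn l y) (hπ' l)).1 hS j (mem_univ j)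
    rw [(mul_eq_zero.1 this).resolve_right (hπ j).ne', mul_zero]
  · rw [div_self hS, one_mul]

theorem tendsto_fMatrix (hf : ∀ i, IsDensity ν (f i)) (hπ : ∀ i, 0 < π i) {p : ℕ → Fin n → ℝ}
    (hp0 : ∀ T i, 0 ≤ p T i) (hp : Tendsto p atTop (𝓝 π)) :
    Tendsto (fun T => fMatrix ν f (p T)) atTop (𝓝 (fMatrix ν f π)) := by
  refine tendsto_pi_nhds.2 fun k => tendsto_pi_nhds.2 fun j => ?_
  rw [Metric.tendsto_nhds]
  intro ε hε
  filter_upwards [eventually_abs_posterior_sub_le (fun i => (hf i).nonneg) hπ hp (half_pos hε)]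
    with T hT
  rw [Real.dist_eq]
  simp only [fMatrix, Matrix.of_apply]
  rw [← integral_sub (integrable_posterior_mul hf (hp0 T) k j)
    (integrable_posterior_mul hf (fun i => (hπ i).le) k j)]
  calc |∫ y, (posterior f (p T) k y * f j y - posterior f π k y * f j y) ∂ν|
      ≤ ∫ y, ε / 2 * f j y ∂ν := by
        rw [← Real.norm_eq_abs]
        refine norm_integral_le_of_norm_le ((hf j).integrable.const_mul _)
          (ae_of_all _ fun y => ?_)
        rw [Real.norm_eq_abs, ← sub_mul, abs_mul, abs_of_nonneg ((hf j).nonneg y)]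
        exact mul_le_mul_of_nonneg_right (hT k y) ((hf j).nonneg y)
    _ = ε / 2 := by rw [integral_const_mul, (hf j).integral_eq_one, mul_one]
    _ < ε := half_lt_self hε

/-- The diagonal entry `∫ f k ^ 2` is positive, since otherwise `f k` would vanish almost
everywhere. The first program thus has no degenerate weights in the limit. -/
theorem kMatrix_mulVec_pos (hf : ∀ i, IsDensity ν (f i))
    (hint : ∀ i j, Integrable (fun y => f i y * f j y) ν) (hπ : ∀ i, 0 < π i) (k : Fin n) :
    0 < (kMatrix ν f).mulVec π k := by
  have hnn : ∀ i j, 0 ≤ kMatrix ν f i j := fun i j =>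
    integral_nonneg fun y => mul_nonneg ((hf i).nonneg y) ((hf j).nonneg y)
  have hkk : 0 < kMatrix ν f k k := by
    refine (hnn k k).lt_of_ne' fun h0 => ?_
    rw [kMatrix, Matrix.of_apply, integral_eq_zero_iff_of_nonneg
      (fun y => mul_nonneg ((hf k).nonneg y) ((hf k).nonneg y)) (hint k k)] at h0
    have : ∫ y, f k y ∂ν = 0 := integral_eq_zero_of_ae (h0.mono fun y hy => by simpa using hy)
    rw [(hf k).integral_eq_one] at this
    exact one_ne_zero this
  rw [Matrix.mulVec, dotProduct]
  exact sum_pos' (fun j _ => mul_nonneg (hnn k j) (hπ j).le) ⟨k, mem_univ k, mul_pos hkk (hπ k)⟩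

variable {Ω : Type*} [MeasurableSpace Ω] {P : Measure Ω} [IsProbabilityMeasure P]
  {A : Matrix (Fin n) (Fin n) ℝ} {p₀ : Fin n → ℝ} {X : ℕ → Ω → Fin n} {Y : ℕ → Ω → 𝒴}

theorem IsHMM.ae_tendsto_xiHat (h : IsHMM P A p₀ (densityEmission ν f) X Y)
    (hA : IsColStochastic A) (hp₀ : p₀ ∈ stdSimplex ℝ (Fin n)) (hgeo : IsGeometricallyErgodic A π)
    (hf : ∀ i, IsDensity ν (f i)) (hint : ∀ i j, Integrable (fun y => f i y * f j y) ν) :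
    ∀ᵐ ω ∂P, ∀ k, Tendsto (fun T => xiHat f (fun t => Y t ω) T k) atTop
      (𝓝 ((kMatrix ν f).mulVec π k)) := by
  have := isProbabilityMeasure_densityEmission hf
  refine ae_all_iff.2 fun k => ?_
  have key := h.ae_tendsto_average_single hA hp₀ hgeo (hf k).measurable (hf k).nonneg
    fun i => (integrable_densityEmission_iff hf i).2 (hint k i)
  simp only [integral_densityEmission hf] at key
  exact key

/-- The exceptional null set is fixed before the sequence `p`, so a data-dependent sequence may be
inserted afterwards. -/
theorem IsHMM.ae_tendsto_etaHat (h : IsHMM P A p₀ (densityEmission ν f) X Y)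
    (hA : IsColStochastic A) (hp₀ : p₀ ∈ stdSimplex ℝ (Fin n)) (hgeo : IsGeometricallyErgodic A π)
    (hπ : ∀ i, 0 < π i) (hf : ∀ i, IsDensity ν (f i)) :
    ∀ᵐ ω ∂P, ∀ p : ℕ → Fin n → ℝ, (∀ T i, 0 ≤ p T i) → Tendsto p atTop (𝓝 π) → ∀ k k',
      Tendsto (fun T => etaHat f (p T) (fun t => Y t ω) T k k') atTop
        (𝓝 (pairMap π (fMatrix ν f π) A (k, k'))) ∧
      (pairMap π (fMatrix ν f π) A (k, k') = 0 →
        ∀ T, etaHat f (p T) (fun t => Y t ω) T k k' = 0) := by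
  have := isProbabilityMeasure_densityEmission hf
  have hnn := fun i => (hf i).nonneg
  have hπ' := fun i => (hπ i).le
  have hm := measurable_posterior (fun i => (hf i).measurable) π
  have hlim : ∀ k k', pairMean A (densityEmission ν f) (posterior f π k) (posterior f π k') π =
      pairMap π (fMatrix ν f π) A (k, k') := fun k k' => by
    simp only [pairMean, pairMap, integral_densityEmission hf, fMatrix, Matrix.of_apply]
  have key : ∀ᵐ ω ∂P, ∀ k k', Tendsto (fun T => etaHat f π (fun t => Y t ω) T k k') atTop
      (𝓝 (pairMap π (fMatrix ν f π) A (k, k'))) := by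
    refine ae_all_iff.2 fun k => ae_all_iff.2 fun k' => ?_
    rw [← hlim]
    exact h.ae_tendsto_average_pair hA hp₀ hgeo (hm k) (hm k') (posterior_nonneg hnn hπ' k)
      (fun i => (integrable_densityEmission_iff hf i).2 (integrable_posterior_mul hf hπ' k i))
      (posterior_nonneg hnn hπ' k') (posterior_le_one hnn hπ' k')
  have hzero : ∀ᵐ ω ∂P, ∀ k k', pairMap π (fMatrix ν f π) A (k, k') = 0 →
      ∀ t, posterior f π k (Y t ω) * posterior f π k' (Y (t + 1) ω) = 0 := by
    refine ae_all_iff.2 fun k => ae_all_iff.2 fun k' => ?_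
    by_cases hz : pairMap π (fMatrix ν f π) A (k, k') = 0
    · filter_upwards [h.ae_eq_zero_of_pairMean_eq_zero hA hp₀ hπ (hm k) (hm k')
        (posterior_nonneg hnn hπ' k) (posterior_le_one hnn hπ' k) (posterior_nonneg hnn hπ' k')
        (posterior_le_one hnn hπ' k') (by rw [hlim, hz])] with ω hω _ using hω
    · exact ae_of_all _ fun ω h' => absurd h' hz
  filter_upwards [key, hzero] with ω h1 h2 p hp0 hp k k'
  constructor
  · simpa using (tendsto_etaHat_sub hnn hπ hp0 hp (fun t => Y t ω) k k').add (h1 k k')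
  · intro hz T
    rw [etaHat, sum_eq_zero, mul_zero]
    intro t ht
    have := h2 k k' hz (t - 1)
    rw [Nat.sub_add_cancel (mem_Ico.1 ht).1] at this
    -- A zero posterior under the positive `π` comes from a zero of `f`, which makes the posterior
    -- zero under every `p`.
    rcases mul_eq_zero.1 this with h0 | h0 <;>
      simp [posterior, eq_zero_of_posterior_eq_zero hnn hπ h0]

end Density

end HMM

/-! ### The consistency theorem -/

theorem theorem1 {n : ℕ} {Ω : Type*} [MeasurableSpace Ω]
    (P : Measure Ω) [IsProbabilityMeasure P]
    -- the hidden chain and its standing assumptions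
    (A : Matrix (Fin n) (Fin n) ℝ) (hA : HMM.IsColStochastic A)
    (p₀ : Fin n → ℝ) (hp₀ : p₀ ∈ stdSimplex ℝ (Fin n))
    (π : Fin n → ℝ) (hπ : HMM.IsStationary A π)
    (hπ_unique : ∀ p : Fin n → ℝ, HMM.IsStationary A p → p = π)
    (a₀ : ℝ) (ha₀ : 0 < a₀) (hπ_lower : ∀ k, a₀ ≤ π k)
    (hgeo : HMM.IsGeometricallyErgodic A π)
    (X : ℕ → Ω → Fin n) :
    -- finite output alphabet
    (∀ (m : ℕ) (B : Matrix (Fin m) (Fin n) ℝ) (Y : ℕ → Ω → Fin m),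
      HMM.IsColStochastic B → B.rank = n →
      HMM.IsHMM P A p₀ (HMM.discreteEmission B) X Y →
      (∀ᵐ ω ∂P, Tendsto (fun T => HMM.piHat B (HMM.rhoHat (fun t => Y t ω) T))
        atTop (𝓝 π)) ∧
      (∀ Ahat : ℕ → Ω → Matrix (Fin n) (Fin n) ℝ,
        (∀ T ω, HMM.IsTransitionEstimate
          (HMM.piHat B (HMM.rhoHat (fun t => Y t ω) T)) B
          (HMM.sigmaHat (fun t => Y t ω) T) (Ahat T ω)) →
        ∀ᵐ ω ∂P, Tendsto (fun T => Ahat T ω) atTop (𝓝 A))) ∧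
    -- outputs with densities
    (∀ (𝒴 : Type*) [MeasurableSpace 𝒴] (ν : Measure 𝒴) (f : Fin n → 𝒴 → ℝ) (Y : ℕ → Ω → 𝒴),
      (∀ i, HMM.IsDensity ν (f i)) →
      (∀ i j, Integrable (fun y => f i y * f j y) ν) →
      (HMM.fMatrix ν f π).rank = n → (HMM.kMatrix ν f).rank = n →
      HMM.IsHMM P A p₀ (HMM.densityEmission ν f) X Y →
      ∀ pihat : ℕ → Ω → Fin n → ℝ,
        (∀ T ω, HMM.IsMixtureEstimate (HMM.kMatrix ν f)
          (HMM.xiHat f (fun t => Y t ω) T) (pihat T ω)) →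
        (∀ᵐ ω ∂P, Tendsto (fun T => pihat T ω) atTop (𝓝 π)) ∧
        -- the second program built with the matrix `F` itself
        (∀ Ahat : ℕ → Ω → Matrix (Fin n) (Fin n) ℝ,
          (∀ T ω, HMM.IsTransitionEstimate (pihat T ω) (HMM.fMatrix ν f π)
            (HMM.etaHat f (pihat T ω) (fun t => Y t ω) T) (Ahat T ω)) →
          ∀ᵐ ω ∂P, Tendsto (fun T => Ahat T ω) atTop (𝓝 A)) ∧
        -- the second program built with `F` computed from the estimated state probabilities
        (∀ Ahat : ℕ → Ω → Matrix (Fin n) (Fin n) ℝ,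
          (∀ T ω, HMM.IsTransitionEstimate (pihat T ω) (HMM.fMatrix ν f (pihat T ω))
            (HMM.etaHat f (pihat T ω) (fun t => Y t ω) T) (Ahat T ω)) →
          ∀ᵐ ω ∂P, Tendsto (fun T => Ahat T ω) atTop (𝓝 A))) := by
  have hpos : ∀ k, 0 < π k := fun k => ha₀.trans_le (hπ_lower k)
  refine ⟨fun m B Y hB hrank h => ?_, fun 𝒴 _ ν f Y hf hint hFrank hKrank h pihat hpi => ?_⟩
  · obtain ⟨L, hL⟩ := HMM.exists_left_inverse_of_rank_eq B hrank
    have hlim : ∀ᵐ ω ∂P, Tendsto (fun T => HMM.piHat B (HMM.rhoHat (fun t => Y t ω) T))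
        atTop (𝓝 π) :=
      (h.ae_tendsto_rhoHat hA hp₀ hgeo hB).mono fun ω hω =>
        HMM.tendsto_piHat hB hL hπ.1 hpos hω
    refine ⟨hlim, fun Ahat hAhat => ?_⟩
    filter_upwards [hlim, h.ae_tendsto_sigmaHat hA hp₀ hgeo hpos hB] with ω h1 h2
    exact HMM.tendsto_of_isTransitionEstimate hA hπ ha₀ hπ_lower hB hL h1 tendsto_const_nhds
      (fun k k' => (h2 k k').1) (fun k k' hz => Eventually.of_forall ((h2 k k').2 hz))
      fun T => hAhat T ω
  · obtain ⟨L, hL⟩ := HMM.exists_left_inverse_of_rank_eq _ hFrank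
    obtain ⟨L', hL'⟩ := HMM.exists_left_inverse_of_rank_eq _ hKrank
    have hF := HMM.isColStochastic_fMatrix hf hpos
    have hlim : ∀ᵐ ω ∂P, Tendsto (fun T => pihat T ω) atTop (𝓝 π) :=
      (h.ae_tendsto_xiHat hA hp₀ hgeo hf hint).mono fun ω hω =>
        HMM.tendsto_of_isMixtureEstimate hL' hπ.1 (HMM.kMatrix_mulVec_pos hf hint hpos) hω
          fun T => hpi T ω
    have heta := h.ae_tendsto_etaHat hA hp₀ hgeo hpos hf
    refine ⟨hlim, fun Ahat hAhat => ?_, fun Ahat hAhat => ?_⟩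
    · filter_upwards [hlim, heta] with ω h1 h2
      have h2 := h2 (fun T => pihat T ω) (fun T => (hpi T ω).1.1) h1
      exact HMM.tendsto_of_isTransitionEstimate hA hπ ha₀ hπ_lower hF hL h1 tendsto_const_nhds
        (fun k k' => (h2 k k').1) (fun k k' hz => Eventually.of_forall ((h2 k k').2 hz))
        fun T => hAhat T ω
    · filter_upwards [hlim, heta] with ω h1 h2
      have h2 := h2 (fun T => pihat T ω) (fun T => (hpi T ω).1.1) h1
      exact HMM.tendsto_of_isTransitionEstimate hA hπ ha₀ hπ_lower hF hL h1
        (HMM.tendsto_fMatrix hf hpos (fun T => (hpi T ω).1.1) h1)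
        (fun k k' => (h2 k k').1) (fun k k' hz => Eventually.of_forall ((h2 k k').2 hz))
        fun T => hAhat T ω
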